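/- Let $d,\ell\in\mathbb N$, $0<a<T$, and let $D:\mathbb R^d\to(0,T]$, $f:\mathbb R^d\to\mathbb R$, $\delta>0$, $\mu_1,\dots,\mu_\ell\in\mathbb R^d$ and $\gamma_i:S^{d-1}\to(0,\infty)$ ($1\le i\le\ell$; we write $\gamma_i(a,\vec n)$ for $\gamma_i(\vec n)$) be such that the following hold. * (H1) $D$ is continuous on $\mathbb R^d$ and $D(t)\to0$ as $\|t\|\to\infty$. * (H2) For all $i$ and all $\vec n\in S^{d-1}$: $D(\mu_i)>a$, $D(\mu_i+\gamma_i(a,\vec n)\vec n)=a$, and $\lambda\mapsto D(\mu_i+(\lambda+\gamma_i(a,\vec n))\vec n)$ is strictly decreasing on $(-\delta,\delta)$. Let $\Omega_i\subset(0,T]\times S^{d-1}$ be the set of the pairs $(s,\vec n)$ for which there is a (necessarily unique) $\lambda_s\in(-\delta,\delta)$ with $D(\mu_i+(\lambda_s+\gamma_i(a,\vec n))\vec n)=s$, and put $\tau_i(s,\vec n)=\mu_i+(\lambda_s+\gamma_i(a,\vec n))\vec n$ for $(s,\vec n)\in\Omega_i$. Moreover $\delta$ is so small that $D(\mu_i+(-\delta+\gamma_i(a,\vec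 n))\vec n)<D(\mu_i)$ for all $i$ and $\vec n$, and that the sets $\tau_i(\Omega_i)$ are pairwise disjoint. * (H3) $D$ is of class $\mathcal C^p$ for some $p$ with $1<p\le\infty$; for every $i$ the set $\tau_i(\Omega_i)$ is open, and $\tau_i^{-1}:\tau_i(\Omega_i)\to\Omega_i$ has a differential of full rank at every point of $\tau_i(\Omega_i)$. * (H4) $f$ is a probability density, continuous on an open set $\mathcal U\supset\{t:D(t)\ge a\}\cup\bigcup_i\tau_i(\Omega_i)$. Let $\mathcal D$ be the space of the bounded functions $\mathbb R^d\to\mathbb R$ that are continuous on $\mathcal U$, and let $\mathcal{DG}$ be the space of those that are in addition in $L^1(\mathbb R^d)$, both with the supremum norm; assume $f\in\mathcal{DG}$ (note that $D\in\mathcal D$). Let $a_1<a<a_2<T$ be such that $K=\{t: a_1\le D(t)<a_2\}\subset\bigcup_i\tau_i(\Omega_i)$. Then the functional $$\mathcal T(\tilde y,g)=\int_K t\,1_{\{\tilde y(t)>a\}}\,g(t)\,dt,\qquad(\tilde y,g)\in\mathcal D\times\mathcal{DG},$$ is well defined (the integrand is integrable on $K$) and Hadamard differentiable at $(D,f)$;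 that is, there is a continuous linear map $\mathcal T':\mathcal D\times\mathcal{DG}\to\mathbb R^d$ such that $\varepsilon^{-1}\bigl(\mathcal T((D,f)+\varepsilon h')-\mathcal T(D,f)\bigr)\to\mathcal T'(h)$ as $\varepsilon\to0$ and $h'\to h$, for every $h\in\mathcal D\times\mathcal{DG}$. Its derivative is $$\mathcal T'(\tilde y,g)=\sum_{i=1}^{\ell}\int_{S^{d-1}}\tau_i(a,\vec n)\,f(\tau_i(a,\vec n))\,\bigl|\det(d_{(a,\vec n)}\tau_i)\bigr|\,\tilde y(\tau_i(a,\vec n))\,d\vec n+\int_K t\,1_{\{D(t)\ge a\}}\,g(t)\,dt,$$ where all the integrals converge absolutely; here $d\vec n$ is the surface measure of $S^{d-1}$, and the determinant of $d_{(a,\vec n)}\tau_i:\mathbb R\times T_{\vec n}S^{d-1}\to\mathbb R^d$ is taken in orthonormal bases. The same holds for the functional $(\tilde y,g)\mapsto\int_{\mathbb R^d}t\,1_{\{\tilde y(t)>a\}}\,g(t)\,dt$ (whose integral converges absolutely for $(\tilde y,g)$ close to $(D,f)$), with the same sum over $i$ and with $\int_{\mathbb R^d}t\,1_{\{D(t)\ge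 a\}}\,g(t)\,dt$ as the last term of the derivative. -/

import Mathlib

open MeasureTheory Filter Topology Set
open scoped ENNReal

noncomputable section

namespace TrimmedMean

/-- Euclidean space `ℝ^d`. -/
abbrev Space (d : ℕ) : Type := EuclideanSpace ℝ (Fin d)

/-- The unit sphere `S^{d-1}` of `ℝ^d`. -/
abbrev UnitSphere (d : ℕ) : Type := Metric.sphere (0 : Space d) 1

/-- All bounded functions `ℝ^d → ℝ`, with the supremum norm. -/
abbrev BddFun (d : ℕ) : Type := lp (fun _ : Space d => ℝ) ∞

/-- The space `𝒟` of bounded functions `ℝ^d → ℝ` that are continuous on `U`,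
with the supremum norm. -/
def DepthSpace {d : ℕ} (U : Set (Space d)) : Submodule ℝ (BddFun d) where
  carrier := {y | ContinuousOn (⇑y) U}
  add_mem' := fun hx hy => ContinuousOn.add hx hy
  zero_mem' := continuousOn_const
  smul_mem' := fun c _ hx => ContinuousOn.const_smul hx c

/-- The space `𝒟𝒢` of bounded functions `ℝ^d → ℝ` that are continuous on `U` and
Lebesgue integrable on `ℝ^d`, with the supremum norm. -/
def DensitySpace {d : ℕ} (U : Set (Space d)) : Submodule ℝ (BddFun d) where
  carrier := {g | ContinuousOn (⇑g) U ∧ Integrable (⇑g) volume}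
  add_mem' := fun hx hy => ⟨ContinuousOn.add hx.1 hy.1, Integrable.add hx.2 hy.2⟩
  zero_mem' := ⟨continuousOn_const, integrable_zero _ _ _⟩
  smul_mem' := fun c _ hx => ⟨ContinuousOn.const_smul hx.1 c, Integrable.smul c hx.2⟩

instance {d : ℕ} (U : Set (Space d)) : CoeFun (DepthSpace U) (fun _ => Space d → ℝ) :=
  ⟨fun y => ⇑(y : BddFun d)⟩

instance {d : ℕ} (U : Set (Space d)) : CoeFun (DensitySpace U) (fun _ => Space d → ℝ) :=
  ⟨fun g => ⇑(g : BddFun d)⟩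

/-- `T` is Hadamard differentiable at `x` with (continuous linear) derivative `T'`:
`(T (x + ε • h') - T x) / ε → T' h` as `ε → 0` and `h' → h`, for every direction `h`. -/
def HasHadamardDerivAt {E F : Type*} [NormedAddCommGroup E] [NormedSpace ℝ E]
    [NormedAddCommGroup F] [NormedSpace ℝ F] (T : E → F) (T' : E →L[ℝ] F) (x : E) : Prop :=
  ∀ h : E, Tendsto (fun q : ℝ × E => q.1⁻¹ • (T (x + q.1 • q.2) - T x))
    (𝓝[≠] 0 ×ˢ 𝓝 h) (𝓝 (T' h))

section Polar

variable {d : ℕ} (D : Space d → ℝ) (δ : ℝ) (μ : Space d) (γ : UnitSphere d → ℝ)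

/-- `Ω ⊆ ℝ × S^{d-1}`: the pairs `(s, n)` such that the level `s` of `D` is attained at
`μ + (lam + γ n) n` for some `lam ∈ (-δ, δ)`. -/
def polarDomain : Set (ℝ × UnitSphere d) :=
  {p | ∃ lam ∈ Ioo (-δ) δ, D (μ + (lam + γ p.2) • (p.2 : Space d)) = p.1}

open Classical in
/-- The number `lam_s ∈ (-δ, δ)` at which the level `s` is attained in the direction `n`
(the value `0` is used for `(s, n)` outside `Ω`). -/
def levelShift (p : ℝ × UnitSphere d) : ℝ :=
  if h : ∃ lam ∈ Ioo (-δ) δ, D (μ + (lam + γ p.2) • (p.2 : Space d)) = p.1 then h.choose else 0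

/-- The map `τ(s, n) = μ + (lam_s + γ n) n`. -/
def tau (p : ℝ × UnitSphere d) : Space d :=
  μ + (levelShift D δ μ γ p + γ p.2) • (p.2 : Space d)

/-- The image `τ(Ω)`. -/
def tauImage : Set (Space d) := tau D δ μ γ '' polarDomain D δ μ γ

/-- The inverse `τ⁻¹ : τ(Ω) → Ω ⊆ ℝ × S^{d-1} ⊆ ℝ × ℝ^d` (extended by `0` off `τ(Ω)`). -/
def tauInv : Space d → ℝ × Space d :=
  Function.extend (fun p : polarDomain D δ μ γ => tau D δ μ γ p.1)
    (fun p : polarDomain D δ μ γ => (p.1.1, (p.1.2 : Space d))) 0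

end Polar

/-- The point `(n + v) / ‖n + v‖` of the sphere, where `v = x - ⟪n, x⟫ n` is the component of
`x` tangent to the sphere at `n`.  On `T_n S^{d-1} = n^⊥` this is a parametrization of the sphere
around `n` whose differential at `0` is the identity of `T_n S^{d-1}`. -/
def sphereParam {d : ℕ} (n : UnitSphere d) (x : Space d) : UnitSphere d :=
  ⟨‖(n : Space d) + (x - inner ℝ (n : Space d) x • (n : Space d))‖⁻¹ •
      ((n : Space d) + (x - inner ℝ (n : Space d) x • (n : Space d))), by
    have hn : ‖(n : Space d)‖ = 1 := by simp
    have h0 : (n : Space d) + (x - inner ℝ (n : Space d) x • (n : Space d)) ≠ 0 := by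
      intro h
      have h1 := congrArg (fun w => inner ℝ (n : Space d) w) h
      simp [inner_add_right, inner_sub_right, inner_smul_right, hn] at h1
    rw [mem_sphere_zero_iff_norm, norm_smul, norm_inv, norm_norm,
      inv_mul_cancel₀ (norm_ne_zero_iff.mpr h0)]⟩

/-- `|det d_{(s,n)} σ|` for a map `σ` from (a subset of) `ℝ × S^{d-1}` to `ℝ^d`: the absolute
value of the determinant, in orthonormal bases, of the differential
`ℝ × T_n S^{d-1} → ℝ^d`.  The domain is identified with `ℝ^d` through the linear isometry
`(r, v) ↦ r n + v`. -/
def absJacobian {d : ℕ} (σ : ℝ × UnitSphere d → Space d) (s : ℝ) (n : UnitSphere d) : ℝ :=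
  |(fderiv ℝ (fun x : Space d => σ (s + inner ℝ (n : Space d) x, sphereParam n x)) 0).det|

/-- Continuity of the depth and decay at infinity. -/
structure H1 {d : ℕ} (D : Space d → ℝ) : Prop where
  continuous : Continuous D
  tendsto_zero : Tendsto D (Bornology.cobounded (Space d)) (𝓝 0)

/-- The depth is strictly decreasing along each ray from each centre `μ i`, in the
`δ`-neighbourhood of a radius `γ i n` at which the level `a` is attained. -/
structure H2 {d l : ℕ} (D : Space d → ℝ) (a δ : ℝ) (μ : Fin l → Space d)
    (γ : Fin l → UnitSphere d → ℝ) : Prop where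
  delta_pos : 0 < δ
  lt_center : ∀ i, a < D (μ i)
  radius_pos : ∀ i n, 0 < γ i n
  strictAnti : ∀ i n,
    StrictAntiOn (fun lam : ℝ => D (μ i + (lam + γ i n) • (n : Space d))) (Ioo (-δ) δ)
  level : ∀ i n, D (μ i + γ i n • (n : Space d)) = a

/-- The requirements that `δ` be small: each ray segment stays below the depth of its centre,
and the images of the maps `τ i` are pairwise disjoint. -/
structure SmallDelta {d l : ℕ} (D : Space d → ℝ) (δ : ℝ) (μ : Fin l → Space d)
    (γ : Fin l → UnitSphere d → ℝ) : Prop where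
  lt_center : ∀ i n, D (μ i + (-δ + γ i n) • (n : Space d)) < D (μ i)
  disjoint : ∀ i j, i ≠ j → Disjoint (tauImage D δ (μ i) (γ i)) (tauImage D δ (μ j) (γ j))

/-- The depth is of class `C^p`, and the inverses `τ i ⁻¹`, defined on the open sets
`τ i (Ω i)`, have no singular points. -/
structure H3 {d l : ℕ} (p : ℕ∞) (D : Space d → ℝ) (δ : ℝ) (μ : Fin l → Space d)
    (γ : Fin l → UnitSphere d → ℝ) : Prop where
  one_lt : 1 < p
  contDiff : ContDiff ℝ p D
  isOpen_image : ∀ i, IsOpen (tauImage D δ (μ i) (γ i))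
  full_rank : ∀ i, ∀ x ∈ tauImage D δ (μ i) (γ i),
    Function.Injective (fderiv ℝ (tauInv D δ (μ i) (γ i)) x)

/-- `f` is a probability density, continuous on the open set `U`, which contains
`{D ≥ a}` and the images of the maps `τ i`. -/
structure H4 {d l : ℕ} (D : Space d → ℝ) (a δ : ℝ) (μ : Fin l → Space d)
    (γ : Fin l → UnitSphere d → ℝ) (U : Set (Space d)) (f : Space d → ℝ) : Prop where
  nonneg : ∀ᵐ t, 0 ≤ f t
  integral_eq_one : ∫ t, f t = 1
  isOpen : IsOpen U
  continuousOn : ContinuousOn f U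
  level_subset : {t | a ≤ D t} ⊆ U
  image_subset : ∀ i, tauImage D δ (μ i) (γ i) ⊆ U

/-- The functional `(y, g) ↦ ∫_A t 1{y(t) > a} g(t) dt`. -/
def trimmed {d : ℕ} (a : ℝ) (A : Set (Space d)) (y g : Space d → ℝ) : Space d :=
  ∫ t in A, indicator {t | a < y t} (fun t => g t • t) t

/-- The integrand `τ(a,n) f(τ(a,n)) |det d_{(a,n)} τ| y(τ(a,n))` of the surface term. -/
def surfaceIntegrand {d : ℕ} (D : Space d → ℝ) (a δ : ℝ) (μ : Space d) (γ : UnitSphere d → ℝ)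
    (f y : Space d → ℝ) (n : UnitSphere d) : Space d :=
  (f (tau D δ μ γ (a, n)) * absJacobian (tau D δ μ γ) a n * y (tau D δ μ γ (a, n))) •
    tau D δ μ γ (a, n)

/-- The linear functional
`(y, g) ↦ ∑ i, ∫_{S^{d-1}} τᵢ(a,n) f(τᵢ(a,n)) |det d_{(a,n)} τᵢ| y(τᵢ(a,n)) dn
  + ∫_A t 1{D(t) ≥ a} g(t) dt`,
where `dn` is the surface measure of the sphere. -/
def trimmedDeriv {d l : ℕ} (D : Space d → ℝ) (a δ : ℝ) (μ : Fin l → Space d)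
    (γ : Fin l → UnitSphere d → ℝ) (f : Space d → ℝ) (A : Set (Space d))
    (y g : Space d → ℝ) : Space d :=
  (∑ i, ∫ n, surfaceIntegrand D a δ (μ i) (γ i) f y n ∂(volume : Measure (Space d)).toSphere) +
    ∫ t in A, indicator {t | a ≤ D t} (fun t => g t • t) t

end TrimmedMean

end

open TrimmedMean

namespace TrimmedMean

/-! In direction `(y, g)` the difference quotient splits as in a product rule, into `ε⁻¹ ∫ (1{D + εy
> a} - 1{D > a}) f(t) t dt` and `∫ 1{D + εy > a} g(t) t dt`. The second term converges by dominated
convergence, because `{D = a}` is a null set (`TransversalLevel.tendsto_mass`).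

The jump in the first term vanishes unless `|D - a| ≤ |εy|`. For small `ε` it therefore lives in the
band around the level set that the disjoint tubes `τ i (Ω i)` cover, and each tube can be treated
alone. There one uses polar coordinates about `μ i` and rescales `r = γ n + ε u`. With `x = μ + γ n
• n` and the radial slope `κ n < 0` of `D` at `x`, the rescaled integrand tends to `γ^(d-1) f(x)
(1{uκ + y(x) > 0} - 1{uκ > 0}) x`, and integrating over `u` gives the factor `y(x) / |κ|`.
Transversality, `c |r - γ n| ≤ |D - a|`, confines `u` to a fixed bounded interval, which provides
the dominating function (`RadialChart.tendsto_integral_jump`).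

The hypotheses supply this picture as follows. Full rank of `τ⁻¹` forbids a zero radial slope
(`fderiv_ray_neg`), openness of the tubes makes `γ` continuous (`continuous_radius_of_isOpen`), and
compactness of the band inside each tube makes the slope bound uniform (`exists_radial_bound`).
Finally `γ^(d-1) / |κ|` is the Jacobian of `τ` (`absJacobian_tau`): the inverse function theorem is
applied to an explicit inverse, so `τ` itself is never differentiated by hand. -/

theorem map_val_volumeIoiPow (m : ℕ) :
    (Measure.volumeIoiPow m).map Subtype.val =
      ((volume : Measure ℝ).restrict (Ioi 0)).withDensity fun r => ENNReal.ofReal (r ^ m) := by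
  ext s hs
  rw [Measure.map_apply measurable_subtype_coe hs, Measure.volumeIoiPow,
    withDensity_apply _ (measurable_subtype_coe hs), withDensity_apply _ hs,
    setLIntegral_subtype measurableSet_Ioi _ fun a : ℝ => ENNReal.ofReal (a ^ m),
    Measure.restrict_restrict hs, Subtype.image_preimage_coe, inter_comm]

/-! ### Integration in polar coordinates on the product of the sphere and the whole line -/

section Polar

variable {E F : Type*} [NormedAddCommGroup E] [NormedSpace ℝ E] [MeasurableSpace E] [BorelSpace E]
  [FiniteDimensional ℝ E] [NormedAddCommGroup F] [NormedSpace ℝ F]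
  (ν : Measure E) [ν.IsAddHaarMeasure]

/-- The integrand `r ^ (dim E - 1) G (r n)` of integration in polar coordinates. -/
noncomputable def polarIntegrand (G : E → F) (q : Metric.sphere (0 : E) 1 × ℝ) : F :=
  (Ioi (0 : ℝ)).indicator (fun r => r ^ (Module.finrank ℝ E - 1) • G (r • (q.1 : E))) q.2

omit [MeasurableSpace E] [BorelSpace E] [FiniteDimensional ℝ E] in
theorem polarIntegrand_eq_indicator (G : E → F) :
    polarIntegrand G = ((univ : Set (Metric.sphere (0 : E) 1)) ×ˢ Ioi (0 : ℝ)).indicator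
      fun q => q.2 ^ (Module.finrank ℝ E - 1) • G (q.2 • (q.1 : E)) := by
  ext q
  by_cases h : 0 < q.2 <;> simp [polarIntegrand, h]

theorem ae_pos_snd :
    ∀ᵐ q ∂(ν.toSphere.prod ((volume : Measure ℝ).restrict (Ioi 0))), 0 < q.2 := by
  have := ae_restrict_mem (μ := ν.toSphere.prod (volume : Measure ℝ))
    ((MeasurableSet.univ (α := Metric.sphere (0 : E) 1)).prod (measurableSet_Ioi (a := (0 : ℝ))))
  rw [← Measure.prod_restrict, Measure.restrict_univ] at this
  filter_upwards [this] with q hq using hq.2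

/-- Here the radius is a real number rather than a point of the subtype `Ioi 0`. Extending by zero
to `r ≤ 0` then allows translations and dilations of the radial variable on all of `ℝ`. -/
theorem measurePreserving_polar :
    MeasurePreserving (fun x : ({0}ᶜ : Set E) =>
        Prod.map id (Subtype.val : Ioi (0 : ℝ) → ℝ) (homeomorphUnitSphereProd E x))
      (ν.comap (↑)) ((ν.toSphere.prod (volume.restrict (Ioi 0))).withDensity
        fun q => ENNReal.ofReal (q.2 ^ (Module.finrank ℝ E - 1))) := by
  have h1 := ν.measurePreserving_homeomorphUnitSphereProd
  have h2 : MeasurePreserving (Subtype.val : Ioi (0 : ℝ) → ℝ)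
      (Measure.volumeIoiPow (Module.finrank ℝ E - 1)) _ :=
    ⟨measurable_subtype_coe, map_val_volumeIoiPow _⟩
  have : SFinite (((volume : Measure ℝ).restrict (Ioi 0)).withDensity
    fun r => ENNReal.ofReal (r ^ (Module.finrank ℝ E - 1))) := inferInstance
  have h3 := ((MeasurePreserving.id ν.toSphere).prod h2).comp h1
  rwa [prod_withDensity_right (by fun_prop)] at h3

omit [FiniteDimensional ℝ E] in
theorem measurableEmbedding_polar : MeasurableEmbedding (fun x : ({0}ᶜ : Set E) =>
    Prod.map id (Subtype.val : Ioi (0 : ℝ) → ℝ) (homeomorphUnitSphereProd E x)) :=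
  (MeasurableEmbedding.id.prodMap (MeasurableEmbedding.subtype_coe measurableSet_Ioi)).comp
    (homeomorphUnitSphereProd E).measurableEmbedding

theorem integrable_polarIntegrand {G : E → F} (hG : Integrable G ν) :
    Integrable (polarIntegrand G) (ν.toSphere.prod volume) := by
  rw [polarIntegrand_eq_indicator,
    integrable_indicator_iff (MeasurableSet.univ.prod measurableSet_Ioi), IntegrableOn,
    ← Measure.prod_restrict, Measure.restrict_univ]
  have h := (measurePreserving_polar ν).integrable_comp_emb measurableEmbedding_polar
    (g := fun q => G (q.2 • (q.1 : E)))
  rw [integrable_withDensity_iff_integrable_smul' (by fun_prop) (by simp)] at h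
  have h1 : Integrable (fun x : ({0}ᶜ : Set E) => G x) (ν.comap (↑)) := by
    have := (integrableOn_iff_comap_subtypeVal (s := ({0}ᶜ : Set E)) (by measurability)).1
      hG.integrableOn
    simpa [Function.comp_def] using this
  refine (h.1 ?_).congr ?_
  · convert h1 using 2 with x
    have : ‖x.1‖ ≠ 0 := norm_ne_zero_iff.2 x.2
    simp [smul_smul, this]
  · filter_upwards [ae_pos_snd ν] with q hq
    have : 0 < q.2 := hq
    rw [ENNReal.toReal_ofReal (by positivity)]

theorem integral_polarIntegrand [Nontrivial E] (G : E → F) :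
    ∫ q, polarIntegrand G q ∂(ν.toSphere.prod volume) = ∫ x, G x ∂ν := by
  rw [polarIntegrand_eq_indicator, integral_indicator (MeasurableSet.univ.prod measurableSet_Ioi),
    ← Measure.prod_restrict, Measure.restrict_univ]
  calc _ = ∫ q, (ENNReal.ofReal (q.2 ^ (Module.finrank ℝ E - 1))).toReal • G (q.2 • (q.1 : E))
        ∂(ν.toSphere.prod ((volume : Measure ℝ).restrict (Ioi 0))) := by
        refine integral_congr_ae ?_
        filter_upwards [ae_pos_snd ν] with q hq
        have : 0 < q.2 := hq
        rw [ENNReal.toReal_ofReal (by positivity)]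
    _ = ∫ x : ({0}ᶜ : Set E), G x ∂(ν.comap (↑)) := by
        rw [← integral_withDensity_eq_integral_toReal_smul (by fun_prop) (by simp),
          ← (measurePreserving_polar ν).integral_comp measurableEmbedding_polar
            (fun q => G (q.2 • (q.1 : E)))]
        congr 1 with x
        have : ‖x.1‖ ≠ 0 := norm_ne_zero_iff.2 x.2
        simp [smul_smul, this]
    _ = _ := by
        rw [integral_subtype_comap (measurableSet_singleton (0 : E)).compl G,
          restrict_compl_singleton]

end Polar

/-! ### The step function and its rescaling -/

open Classical in
/-- The indicator of `a < s`. -/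
noncomputable def step (a s : ℝ) : ℝ := if a < s then 1 else 0

theorem measurable_step (a : ℝ) : Measurable (step a) :=
  Measurable.ite measurableSet_Ioi measurable_const measurable_const

theorem abs_step_sub_step_le (a s t : ℝ) : |step a s - step a t| ≤ 1 := by
  unfold step; split_ifs <;> simp

theorem abs_sub_le_of_step_ne {a s v : ℝ} (h : step a (s + v) - step a s ≠ 0) :
    |s - a| ≤ |v| := by
  unfold step at h
  rw [abs_le]
  have h1 := le_abs_self v
  have h2 := neg_abs_le v
  split_ifs at h <;> first | (simp at h; done) | (constructor <;> linarith)

/-- A negative `ε` replaces each step by its complement, since the arguments are nonzero, so the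
difference changes sign; the factor `ε⁻¹ * |ε|`, the sign of `ε`, undoes this. Both signs of `ε`
thus share one limit. -/
theorem step_zero_mul {ε A B : ℝ} (hε : ε ≠ 0) (hA : A ≠ 0) (hB : B ≠ 0) :
    ε⁻¹ * |ε| * (step 0 (ε * A) - step 0 (ε * B)) = step 0 A - step 0 B := by
  unfold step
  rcases lt_or_gt_of_ne hε with h | h
  · have h1 : ε⁻¹ * |ε| = -1 := by rw [abs_of_neg h]; field_simp
    simp only [h1, mul_pos_iff, h, h.not_gt, false_and, true_and, false_or]
    rcases lt_or_gt_of_ne hA with hA | hA <;> rcases lt_or_gt_of_ne hB with hB | hB <;>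
      simp [hA, hB, hA.not_gt, hB.not_gt]
  · have h1 : ε⁻¹ * |ε| = 1 := by rw [abs_of_pos h]; field_simp
    simp [h1, h]

theorem tendsto_step_zero {α : Type*} {l : Filter α} {A : α → ℝ} {b : ℝ} (hb : b ≠ 0)
    (h : Tendsto A l (𝓝 b)) : ∀ᶠ x in l, A x ≠ 0 ∧ step 0 (A x) = step 0 b := by
  rcases lt_or_gt_of_ne hb with hb | hb
  · filter_upwards [h.eventually (gt_mem_nhds hb)] with x hx
    exact ⟨hx.ne, by simp [step, hx.not_gt, hb.not_gt]⟩
  · filter_upwards [h.eventually (lt_mem_nhds hb)] with x hx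
    exact ⟨hx.ne', by simp [step, hx, hb]⟩

theorem integral_step_sub_step {κ b : ℝ} (hκ : κ < 0) :
    ∫ u, (step 0 (u * κ + b) - step 0 (u * κ)) = b / |κ| := by
  have h0 : 0 < -κ := by linarith
  have h1 : ∀ u, 0 < u * κ + b ↔ u < b / |κ| := fun u => by
    rw [abs_of_neg hκ, lt_div_iff₀ h0]; constructor <;> intro h <;> linarith
  have h2 : ∀ u, 0 < u * κ ↔ u < 0 := fun u => by
    constructor
    · intro h; by_contra! hu; nlinarith
    · intro h; exact mul_pos_of_neg_of_neg h hκ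
  simp only [step, h1, h2]
  set c := b / |κ|
  rcases le_total 0 c with hc | hc
  · have : (fun u : ℝ => ((if u < c then 1 else 0) - (if u < 0 then 1 else 0) : ℝ)) =
        (Ico 0 c).indicator 1 := by
      ext u
      by_cases hu : u < c <;> by_cases hu0 : u < 0 <;>
        simp [indicator, hu, hu0] <;> grind
    rw [this, integral_indicator_one measurableSet_Ico]; simp [hc]
  · have : (fun u : ℝ => ((if u < c then 1 else 0) - (if u < 0 then 1 else 0) : ℝ)) =
        fun u => - (Ico c 0).indicator 1 u := by
      ext u
      by_cases hu : u < c <;> by_cases hu0 : u < 0 <;>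
        simp [indicator, hu, hu0] <;> grind
    rw [this, integral_neg, integral_indicator_one measurableSet_Ico]; simp [hc]

/-- A tubular neighbourhood `V` of the level set `{μ + γ n • n} ⊆ {D = a}`, in which `D` crosses
the level `a` transversally along the rays from `μ`, with slope `κ n`. -/
structure RadialChart {d : ℕ} (D : Space d → ℝ) (a η : ℝ) (μ : Space d)
    (γ κ : UnitSphere d → ℝ) (V : Set (Space d)) : Prop where
  eta_pos : 0 < η
  isOpen : IsOpen V
  isBounded : Bornology.IsBounded V
  continuous_radius : Continuous γ
  radius_pos : ∀ n, 0 < γ n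
  continuous_slope : Continuous κ
  slope_neg : ∀ n, κ n < 0
  mem : ∀ n, μ + γ n • (n : Space d) ∈ V
  level : ∀ n, D (μ + γ n • (n : Space d)) = a
  hasDerivAt : ∀ n : UnitSphere d, HasDerivAt (fun r : ℝ => D (μ + r • (n : Space d))) (κ n) (γ n)
  exists_bound : ∃ c > 0, ∀ (n : UnitSphere d) (r : ℝ), 0 < r → μ + r • (n : Space d) ∈ V →
    |D (μ + r • (n : Space d)) - a| ≤ η → c * |r - γ n| ≤ |D (μ + r • (n : Space d)) - a|

theorem abs_apply_le_norm {d : ℕ} {U : Set (Space d)} (y : DepthSpace U) (t : Space d) :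
    |y t| ≤ ‖y‖ :=
  lp.norm_apply_le_norm ENNReal.top_ne_zero (y : BddFun d) t

/-- Uniform convergence of the directions and continuity of the limit at `x₀` allow the evaluation
point to move too. This is what Hadamard differentiability needs beyond a fixed direction. -/
theorem tendsto_apply_of_tendsto {d : ℕ} {U : Set (Space d)} {α : Type*} {l : Filter α}
    {y : α → DepthSpace U} {h : DepthSpace U} {x : α → Space d} {x₀ : Space d}
    (hy : Tendsto y l (𝓝 h)) (hx : Tendsto x l (𝓝 x₀)) (hU : U ∈ 𝓝 x₀) :
    Tendsto (fun q => y q (x q)) l (𝓝 (h x₀)) := by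
  have h1 : Tendsto (fun q => h (x q)) l (𝓝 (h x₀)) :=
    (h.2.continuousAt hU).tendsto.comp hx
  have h2 : Tendsto (fun q => y q (x q) - h (x q)) l (𝓝 0) := by
    refine squeeze_zero_norm (fun q => ?_) (tendsto_iff_norm_sub_tendsto_zero.1 hy)
    exact abs_apply_le_norm (y q - h) (x q)
  simpa using h2.add h1

/-! ### First-order asymptotics of the jump in one chart -/

section Asymptotics

variable {d : ℕ} {U V : Set (Space d)} {D f : Space d → ℝ} {a η : ℝ} {μ : Space d}
  {γ κ : UnitSphere d → ℝ}

/-- The integrand `(1{D + v > a} - 1{D > a}) f(t) t`, cut off outside `V ∩ {|D - a| < η}`. -/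
noncomputable def jumpIntegrand (D : Space d → ℝ) (a η : ℝ) (V : Set (Space d))
    (f v : Space d → ℝ) : Space d → Space d :=
  (V ∩ {t | |D t - a| < η}).indicator
    fun t => ((step a (D t + v t) - step a (D t)) * f t) • t

theorem measurable_jumpIntegrand (hV : IsOpen V) (hD : Continuous D) {v : Space d → ℝ}
    (hf : ContinuousOn f V) (hv : ContinuousOn v V) :
    Measurable (jumpIntegrand D a η V f v) := by
  have hVm := hV.measurableSet
  have hext : ∀ {w : Space d → ℝ}, ContinuousOn w V → Measurable (V.indicator w) := by
    intro w hw
    classical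
    rw [← piecewise_eq_indicator]
    exact hw.measurable_piecewise continuousOn_const hVm
  have hf' := hext hf
  have hv' := hext hv
  have hW : MeasurableSet (V ∩ {t | |D t - a| < η}) :=
    hVm.inter (isOpen_lt (by fun_prop) continuous_const).measurableSet
  -- Off `V` the functions `f` and `v` need not be measurable, so they are replaced by their
  -- extensions by zero.
  have : jumpIntegrand D a η V f v = (V ∩ {t | |D t - a| < η}).indicator
      fun t => ((step a (D t + V.indicator v t) - step a (D t)) * V.indicator f t) • t := by
    refine indicator_congr fun t ht => ?_
    rw [indicator_of_mem ht.1, indicator_of_mem ht.1]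
  rw [this]
  have hs := measurable_step a
  refine Measurable.indicator ?_ hW
  exact ((((hs.comp (hD.measurable.add hv')).sub (hs.comp hD.measurable)).mul hf').smul
    measurable_id)

theorem norm_jumpIntegrand_le {v : Space d → ℝ} {C R : ℝ} (hC : ∀ t, |f t| ≤ C)
    (hR : ∀ t ∈ V, ‖t‖ ≤ R) (hC0 : 0 ≤ C) (hR0 : 0 ≤ R) (t : Space d) :
    ‖jumpIntegrand D a η V f v t‖ ≤ C * R := by
  unfold jumpIntegrand
  by_cases ht : t ∈ V ∩ {t | |D t - a| < η}
  · rw [indicator_of_mem ht, norm_smul, norm_mul]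
    have h1 : ‖step a (D t + v t) - step a (D t)‖ ≤ 1 := abs_step_sub_step_le ..
    calc _ ≤ (1 * C) * R := by
          gcongr
          · exact hC t
          · exact hR t ht.1
      _ = _ := by ring
  · rw [indicator_of_notMem ht, norm_zero]; positivity

/-- The jump integrand of the direction `v`, in polar coordinates `(n, r)` around `μ`, rescaled
by `r = γ n + ε u`. -/
noncomputable def rescaledJump (D : Space d → ℝ) (a η : ℝ) (μ : Space d) (γ : UnitSphere d → ℝ)
    (V : Set (Space d)) (f : Space d → ℝ) (ε : ℝ) (v : Space d → ℝ) (p : UnitSphere d × ℝ) :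
    Space d :=
  (ε⁻¹ * |ε|) • polarIntegrand (fun x => jumpIntegrand D a η V f (fun t => ε * v t) (μ + x))
    (p.1, γ p.1 + ε * p.2)

/-- The pointwise limit of the rescaled jump integrand as `ε → 0`. -/
noncomputable def jumpLimit (μ : Space d) (γ κ : UnitSphere d → ℝ) (f h : Space d → ℝ)
    (p : UnitSphere d × ℝ) : Space d :=
  (γ p.1 ^ (d - 1) * f (μ + γ p.1 • (p.1 : Space d)) *
    (step 0 (p.2 * κ p.1 + h (μ + γ p.1 • (p.1 : Space d))) - step 0 (p.2 * κ p.1))) •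
      (μ + γ p.1 • (p.1 : Space d))

/-- Dividing by `ε` inside the steps turns their arguments into `(D - a) / ε + y` and `(D - a) / ε`,
with limits `u κ + h` and `u κ`. Both limits are nonzero, so the steps are eventually constant and
the other factors converge by continuity. -/
theorem RadialChart.tendsto_rescaledJump (H : RadialChart D a η μ γ κ V) (hD : Continuous D)
    (hVU : V ⊆ U) (hf : ContinuousOn f V) (h : DepthSpace U) (n : UnitSphere d) {u : ℝ}
    (hu : u ≠ 0) (huh : u * κ n + h (μ + γ n • (n : Space d)) ≠ 0) :
    Tendsto (fun q : ℝ × DepthSpace U => rescaledJump D a η μ γ V f q.1 q.2 (n, u))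
      (𝓝[≠] 0 ×ˢ 𝓝 h) (𝓝 (jumpLimit μ γ κ f h (n, u))) := by
  set l : Filter (ℝ × DepthSpace U) := 𝓝[≠] 0 ×ˢ 𝓝 h
  set x₀ : Space d := μ + γ n • (n : Space d)
  have hV₀ : V ∈ 𝓝 x₀ := H.isOpen.mem_nhds (H.mem n)
  have hε' : Tendsto (fun q : ℝ × DepthSpace U => q.1) l (𝓝[≠] 0) := tendsto_fst
  have hε : Tendsto (fun q : ℝ × DepthSpace U => q.1) l (𝓝 0) := hε'.mono_right nhdsWithin_le_nhds
  have hr : Tendsto (fun q : ℝ × DepthSpace U => γ n + q.1 * u) l (𝓝 (γ n)) := by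
    simpa using (hε.mul_const u).const_add (γ n)
  have hx : Tendsto (fun q : ℝ × DepthSpace U => μ + (γ n + q.1 * u) • (n : Space d)) l (𝓝 x₀) :=
    (hr.smul_const _).const_add μ
  have hf' : Tendsto (fun q : ℝ × DepthSpace U => f (μ + (γ n + q.1 * u) • (n : Space d))) l
      (𝓝 (f x₀)) := (hf.continuousAt hV₀).tendsto.comp hx
  have hy : Tendsto (fun q : ℝ × DepthSpace U => q.2 (μ + (γ n + q.1 * u) • (n : Space d))) l
      (𝓝 (h x₀)) := tendsto_apply_of_tendsto tendsto_snd hx (mem_of_superset hV₀ hVU)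
  have hB : Tendsto (fun q : ℝ × DepthSpace U =>
      (D (μ + (γ n + q.1 * u) • (n : Space d)) - a) / q.1) l (𝓝 (u * κ n)) := by
    have h1 : HasDerivAt (fun ε : ℝ => D (μ + (γ n + ε * u) • (n : Space d))) (κ n * u) 0 := by
      have h2 : HasDerivAt (fun ε : ℝ => γ n + ε * u) u 0 := by
        simpa using ((hasDerivAt_id (0 : ℝ)).mul_const u).const_add (γ n)
      exact HasDerivAt.comp (0 : ℝ) (h₂ := fun r : ℝ => D (μ + r • (n : Space d)))
        (by simpa using H.hasDerivAt n) h2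
    rw [hasDerivAt_iff_tendsto_slope_zero] at h1
    have h3 := h1.comp hε'
    rw [mul_comm (κ n) u] at h3
    refine h3.congr fun q => ?_
    have h0 : μ + (γ n + 0 * u) • (n : Space d) = x₀ := by simp [x₀]
    simp only [Function.comp_apply, zero_add, h0, smul_eq_mul]
    rw [show D x₀ = a from H.level n]
    ring
  have hA := hB.add hy
  have hW : ∀ᶠ q : ℝ × DepthSpace U in l,
      μ + (γ n + q.1 * u) • (n : Space d) ∈ V ∩ {t | |D t - a| < η} := by
    refine hx.eventually (inter_mem hV₀ ?_)
    refine (isOpen_lt (by fun_prop) continuous_const).mem_nhds ?_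
    simpa [x₀, H.level n] using H.eta_pos
  have hκ : u * κ n ≠ 0 := mul_ne_zero hu (H.slope_neg n).ne
  have key : Tendsto (fun q : ℝ × DepthSpace U => ((γ n + q.1 * u) ^ (d - 1) *
      f (μ + (γ n + q.1 * u) • (n : Space d)) *
      (step 0 (u * κ n + h x₀) - step 0 (u * κ n))) •
        (μ + (γ n + q.1 * u) • (n : Space d))) l (𝓝 (jumpLimit μ γ κ f h (n, u))) :=
    (((hr.pow _).mul hf').mul_const _).smul hx
  refine key.congr' ?_
  filter_upwards [hW, hr.eventually (lt_mem_nhds (H.radius_pos n)),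
    hε'.eventually self_mem_nhdsWithin, tendsto_step_zero hκ hB, tendsto_step_zero huh hA]
    with q hqW hqr hq0 hqB hqA
  have hq0 : q.1 ≠ 0 := hq0
  set x : Space d := μ + (γ n + q.1 * u) • (n : Space d)
  have e1 : step a (D x + q.1 * q.2 x) = step 0 (q.1 * ((D x - a) / q.1 + q.2 x)) := by
    have : q.1 * ((D x - a) / q.1 + q.2 x) = D x + q.1 * q.2 x - a := by field_simp; ring
    simp [step, this]
  have e2 : step a (D x) = step 0 (q.1 * ((D x - a) / q.1)) := by
    have : q.1 * ((D x - a) / q.1) = D x - a := by field_simp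
    simp [step, this]
  have e3 := step_zero_mul hq0 hqA.1 hqB.1
  rw [hqA.2, hqB.2] at e3
  have e4 : polarIntegrand (fun x => jumpIntegrand D a η V f (fun t => q.1 * q.2 t) (μ + x))
      (n, γ n + q.1 * u) = (γ n + q.1 * u) ^ (d - 1) •
        (((step a (D x + q.1 * q.2 x) - step a (D x)) * f x) • x) := by
    unfold polarIntegrand
    rw [indicator_of_mem (show γ n + q.1 * u ∈ Ioi 0 from hqr)]
    simp only [jumpIntegrand, finrank_euclideanSpace_fin]
    rw [indicator_of_mem hqW]
  rw [rescaledJump, e4, e1, e2, smul_smul, smul_smul, ← e3]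
  congr 1
  ring

theorem RadialChart.exists_norm_rescaledJump_le (H : RadialChart D a η μ γ κ V)
    {C : ℝ} (hC : ∀ t, |f t| ≤ C) (h : DepthSpace U) :
    ∃ B M : ℝ, ∀ᶠ q : ℝ × DepthSpace U in 𝓝[≠] 0 ×ˢ 𝓝 h, ∀ p : UnitSphere d × ℝ,
      ‖rescaledJump D a η μ γ V f q.1 q.2 p‖ ≤ (Icc (-B) B).indicator (fun _ => M) p.2 := by
  obtain ⟨c, hc, hcb⟩ := H.exists_bound
  obtain ⟨R, hR⟩ := H.isBounded.exists_norm_le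
  have hC0 : 0 ≤ C := (abs_nonneg _).trans (hC 0)
  set R' := max R 0
  have hR0 : 0 ≤ R' := le_max_right _ _
  have hR' : ∀ t ∈ V, ‖t‖ ≤ R' := fun t ht => (hR t ht).trans (le_max_left _ _)
  -- Once `‖y‖ < ‖h‖ + 1`, a nonzero jump gives `c |ε u| ≤ |D - a| ≤ |ε| (‖h‖ + 1)`, hence the first
  -- bound. In the second, `R' + ‖μ‖` bounds the radius and `C * R'` bounds `|f(t)| ‖t‖`.
  refine ⟨(‖h‖ + 1) / c, (R' + ‖μ‖) ^ (d - 1) * (C * R'), ?_⟩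
  have hn : ∀ᶠ q : ℝ × DepthSpace U in 𝓝[≠] 0 ×ˢ 𝓝 h, ‖q.2‖ < ‖h‖ + 1 :=
    (tendsto_snd (f := 𝓝[≠] (0 : ℝ)) (g := 𝓝 h)).norm.eventually (gt_mem_nhds (by linarith))
  have h0 : ∀ᶠ q : ℝ × DepthSpace U in 𝓝[≠] 0 ×ˢ 𝓝 h, q.1 ≠ 0 :=
    (tendsto_fst (f := 𝓝[≠] (0 : ℝ)) (g := 𝓝 h)).eventually self_mem_nhdsWithin
  filter_upwards [hn, h0] with q hq hq0 p
  have hq0' : 0 < |q.1| := abs_pos.2 hq0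
  have hs : ‖q.1⁻¹ * |q.1|‖ = 1 := by
    rw [norm_mul, norm_inv, Real.norm_eq_abs, Real.norm_eq_abs, abs_abs]
    field_simp
  by_cases hz : rescaledJump D a η μ γ V f q.1 q.2 p = 0
  · rw [hz, norm_zero]
    exact indicator_nonneg (fun _ _ => by positivity) _
  set r := γ p.1 + q.1 * p.2 with hrdef
  have hz1 := smul_ne_zero_iff.1 hz
  have hr : 0 < r := by
    by_contra hr
    refine hz1.2 (indicator_of_notMem ?_ _)
    exact hr
  have hz2 : polarIntegrand (fun x => jumpIntegrand D a η V f (fun t => q.1 * q.2 t) (μ + x))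
      (p.1, r) = r ^ (d - 1) • jumpIntegrand D a η V f (fun t => q.1 * q.2 t)
        (μ + r • (p.1 : Space d)) := by
    unfold polarIntegrand
    rw [indicator_of_mem (show r ∈ Ioi 0 from hr)]
    simp only [finrank_euclideanSpace_fin]
  have hz3 : jumpIntegrand D a η V f (fun t => q.1 * q.2 t) (μ + r • (p.1 : Space d)) ≠ 0 := by
    intro h0
    exact hz1.2 (by rw [hz2, h0, smul_zero])
  have hW : μ + r • (p.1 : Space d) ∈ V ∩ {t | |D t - a| < η} := mem_of_indicator_ne_zero hz3
  have hst : |D (μ + r • (p.1 : Space d)) - a| ≤ |q.1 * q.2 (μ + r • (p.1 : Space d))| := by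
    refine abs_sub_le_of_step_ne fun h0 => hz3 ?_
    rw [jumpIntegrand, indicator_of_mem hW, h0, zero_mul, zero_smul]
  have hu : |p.2| ≤ (‖h‖ + 1) / c := by
    have h1 := hcb p.1 r hr hW.1 hW.2.le
    have h2 : r - γ p.1 = q.1 * p.2 := by rw [hrdef]; ring
    rw [h2, abs_mul] at h1
    rw [abs_mul] at hst
    have h3 := abs_apply_le_norm q.2 (μ + r • (p.1 : Space d))
    rw [le_div_iff₀ hc]
    have h4 : |q.1| * (|p.2| * c) ≤ |q.1| * (‖h‖ + 1) := by
      calc _ = c * (|q.1| * |p.2|) := by ring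
        _ ≤ _ := h1.trans (hst.trans (by gcongr; linarith))
    exact le_of_mul_le_mul_left h4 hq0'
  rw [indicator_of_mem (show p.2 ∈ Icc (-((‖h‖ + 1) / c)) ((‖h‖ + 1) / c) from abs_le.1 hu),
    rescaledJump, norm_smul, hs, one_mul, hz2, norm_smul,
    norm_pow, Real.norm_of_nonneg hr.le]
  have hrR : r ≤ R' + ‖μ‖ := by
    have h1 : ‖(p.1 : Space d)‖ = 1 := by simp
    have h2 : ‖r • (p.1 : Space d)‖ = r := by rw [norm_smul, h1, Real.norm_of_nonneg hr.le, mul_one]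
    calc r = ‖(μ + r • (p.1 : Space d)) - μ‖ := by rw [add_sub_cancel_left, h2]
      _ ≤ _ := (norm_sub_le _ _).trans (by gcongr; exact hR' _ hW.1)
  gcongr
  exact norm_jumpIntegrand_le hC hR' hC0 hR0 _

theorem measurable_polarIntegrand {G : Space d → Space d} (hG : Measurable G) :
    Measurable (polarIntegrand G) := by
  rw [polarIntegrand_eq_indicator]
  refine Measurable.indicator ?_ (MeasurableSet.univ.prod measurableSet_Ioi)
  exact (measurable_snd.pow_const _).smul
    (hG.comp (measurable_snd.smul (measurable_subtype_coe.comp measurable_fst)))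

theorem RadialChart.measurable_rescaledJump (H : RadialChart D a η μ γ κ V) (hD : Continuous D)
    (hf : ContinuousOn f V) {v : Space d → ℝ} (hv : ContinuousOn v V) (ε : ℝ) :
    Measurable (rescaledJump D a η μ γ V f ε v) := by
  have h1 : Measurable (fun x => jumpIntegrand D a η V f (fun t => ε * v t) (μ + x)) :=
    (measurable_jumpIntegrand H.isOpen hD hf (hv.const_smul ε)).comp (measurable_const_add μ)
  have h2 : Measurable fun p : UnitSphere d × ℝ => (p.1, γ p.1 + ε * p.2) :=
    measurable_fst.prodMk ((H.continuous_radius.measurable.comp measurable_fst).add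
      (measurable_snd.const_mul ε))
  exact ((measurable_polarIntegrand h1).comp h2).const_smul (ε⁻¹ * |ε|)

theorem RadialChart.integrable_jumpIntegrand (H : RadialChart D a η μ γ κ V) (hD : Continuous D)
    (hf : ContinuousOn f V) {C : ℝ} (hC : ∀ t, |f t| ≤ C) {v : Space d → ℝ}
    (hv : ContinuousOn v V) : Integrable (jumpIntegrand D a η V f v) := by
  obtain ⟨R, hR⟩ := H.isBounded.exists_norm_le
  have hC0 : 0 ≤ C := (abs_nonneg _).trans (hC 0)
  have hm : MeasurableSet (V ∩ {t | |D t - a| < η}) :=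
    H.isOpen.measurableSet.inter (isOpen_lt (by fun_prop) continuous_const).measurableSet
  have h1 : IntegrableOn (jumpIntegrand D a η V f v) (V ∩ {t | |D t - a| < η}) := by
    refine Measure.integrableOn_of_bounded (M := C * max R 0)
      ((measure_mono inter_subset_left).trans_lt H.isBounded.measure_lt_top).ne
      (measurable_jumpIntegrand H.isOpen hD hf hv).aestronglyMeasurable
      (Eventually.of_forall fun t => norm_jumpIntegrand_le hC
        (fun t ht => (hR t ht).trans (le_max_left _ _)) hC0 (le_max_right _ _) t)
  rw [← integrable_indicator_iff hm] at h1
  refine h1.congr (Eventually.of_forall fun t => ?_)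
  rw [jumpIntegrand, indicator_indicator, inter_self]

/-- By Fubini, on each ray the translation by `γ n` costs nothing and the dilation by `ε` produces
`|ε|⁻¹`, which cancels the `|ε|` built into `rescaledJump`. -/
theorem RadialChart.integral_jumpIntegrand [Nontrivial (Space d)]
    (H : RadialChart D a η μ γ κ V) (hD : Continuous D)
    (hf : ContinuousOn f V) {C : ℝ} (hC : ∀ t, |f t| ≤ C) {v : Space d → ℝ}
    (hv : ContinuousOn v V) {ε : ℝ} (hε : ε ≠ 0)
    (hi : Integrable (rescaledJump D a η μ γ V f ε v)
      ((volume : Measure (Space d)).toSphere.prod volume)) :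
    ε⁻¹ • ∫ t, jumpIntegrand D a η V f (fun t => ε * v t) t =
      ∫ p, rescaledJump D a η μ γ V f ε v p
        ∂((volume : Measure (Space d)).toSphere.prod volume) := by
  have h0 : Integrable (jumpIntegrand D a η V f (fun t => ε * v t)) :=
    H.integrable_jumpIntegrand hD hf hC (hv.const_smul ε)
  have h1 : Integrable (fun x => jumpIntegrand D a η V f (fun t => ε * v t) (μ + x)) :=
    h0.comp_add_left μ
  rw [integral_prod _ hi, ← integral_add_left_eq_self _ μ,
    ← integral_polarIntegrand (volume : Measure (Space d)),
    integral_prod _ (integrable_polarIntegrand _ h1), ← integral_smul]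
  refine integral_congr_ae (Eventually.of_forall fun n => ?_)
  simp only [rescaledJump]
  rw [integral_smul, mul_smul]
  congr 1
  have h2 := Measure.integral_comp_mul_left (fun s => polarIntegrand
    (fun x => jumpIntegrand D a η V f (fun t => ε * v t) (μ + x)) (n, γ n + s)) ε
  rw [h2, integral_add_left_eq_self (fun s => polarIntegrand
    (fun x => jumpIntegrand D a η V f (fun t => ε * v t) (μ + x)) (n, s)), smul_smul, abs_inv,
    mul_inv_cancel₀ (abs_pos.2 hε).ne', one_smul]

/-- By the transversality bound, a ray from `μ` meets the level set within `V` only at radius `γ n`,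
so each radial integral of its indicator vanishes. -/
theorem RadialChart.volume_level_eq_zero [Nontrivial (Space d)]
    (H : RadialChart D a η μ γ κ V) (hD : Continuous D) :
    volume (V ∩ {t | D t = a}) = 0 := by
  set A := V ∩ {t | D t = a}
  have hA : MeasurableSet A :=
    H.isOpen.measurableSet.inter (isClosed_eq hD continuous_const).measurableSet
  have hfin : volume A ≠ ⊤ :=
    ((measure_mono inter_subset_left).trans_lt H.isBounded.measure_lt_top).ne
  have hi : Integrable (A.indicator (1 : Space d → ℝ)) := by
    rw [integrable_indicator_iff hA]
    exact integrableOn_const hfin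
  obtain ⟨c, hc, hcb⟩ := H.exists_bound
  have h0 : ∫ t, A.indicator (1 : Space d → ℝ) t = 0 := by
    rw [← integral_add_left_eq_self _ μ, ← integral_polarIntegrand (volume : Measure (Space d)),
      integral_prod _ (integrable_polarIntegrand _ (hi.comp_add_left μ))]
    refine integral_eq_zero_of_ae (Eventually.of_forall fun n => ?_)
    refine integral_eq_zero_of_ae ?_
    filter_upwards [Measure.ae_ne volume (γ n)] with r hr
    by_cases h : 0 < r
    · have hm : μ + r • (n : Space d) ∉ A := fun hm => by
        have := hcb n r h hm.1 (by simp [show D _ = a from hm.2, H.eta_pos.le])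
        rw [show D _ = a from hm.2, sub_self, abs_zero] at this
        have h1 : 0 < |r - γ n| := abs_pos.2 (sub_ne_zero.2 hr)
        nlinarith
      simp [polarIntegrand, hm]
    · simp [polarIntegrand, h]
  rw [integral_indicator_one hA, measureReal_eq_zero_iff hfin] at h0
  exact h0

/-- For each direction only two values of `u` are excluded, `0` and `-h / κ`, where an argument of
the limiting steps vanishes. -/
theorem RadialChart.ae_nondegenerate (H : RadialChart D a η μ γ κ V) (hVU : V ⊆ U)
    (h : DepthSpace U) :
    ∀ᵐ p : UnitSphere d × ℝ ∂((volume : Measure (Space d)).toSphere.prod volume),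
      p.2 ≠ 0 ∧ p.2 * κ p.1 + h (μ + γ p.1 • (p.1 : Space d)) ≠ 0 := by
  have hh : Continuous fun n : UnitSphere d => h (μ + γ n • (n : Space d)) := by
    refine h.2.comp_continuous ?_ fun n => hVU (H.mem n)
    exact continuous_const.add (H.continuous_radius.smul continuous_subtype_val)
  have hk := H.continuous_slope
  have hc : Continuous fun p : UnitSphere d × ℝ =>
      p.2 * κ p.1 + h (μ + γ p.1 • (p.1 : Space d)) :=
    (continuous_snd.mul (hk.comp continuous_fst)).add (hh.comp continuous_fst)
  have hm : MeasurableSet {p : UnitSphere d × ℝ |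
      p.2 ≠ 0 ∧ p.2 * κ p.1 + h (μ + γ p.1 • (p.1 : Space d)) ≠ 0} :=
    ((isOpen_ne_fun continuous_snd continuous_const).inter
      (isOpen_ne_fun hc continuous_const)).measurableSet
  refine (Measure.ae_prod_iff_ae_ae hm).2 (Eventually.of_forall fun n => ?_)
  have hκ := (H.slope_neg n).ne
  filter_upwards [Measure.ae_ne volume (0 : ℝ),
    Measure.ae_ne volume (-h (μ + γ n • (n : Space d)) / κ n)] with u h1 h2
  refine ⟨h1, fun h3 => h2 ?_⟩
  rw [eq_div_iff hκ]
  linarith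

theorem RadialChart.tendsto_integral_jump [Nontrivial (Space d)]
    (H : RadialChart D a η μ γ κ V) (hD : Continuous D) (hVU : V ⊆ U)
    (hf : ContinuousOn f V) {C : ℝ} (hC : ∀ t, |f t| ≤ C) (h : DepthSpace U) :
    Tendsto (fun q : ℝ × DepthSpace U =>
        q.1⁻¹ • ∫ t, jumpIntegrand D a η V f (fun t => q.1 * q.2 t) t)
      (𝓝[≠] 0 ×ˢ 𝓝 h)
      (𝓝 (∫ n : UnitSphere d, (f (μ + γ n • (n : Space d)) * (γ n ^ (d - 1) / |κ n|) *
        h (μ + γ n • (n : Space d))) • (μ + γ n • (n : Space d))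
          ∂(volume : Measure (Space d)).toSphere)) := by
  set σ := (volume : Measure (Space d)).toSphere
  obtain ⟨B, M, hBM⟩ := H.exists_norm_rescaledJump_le hC h
  have hbi : Integrable (fun p : UnitSphere d × ℝ => (Icc (-B) B).indicator (fun _ => M) p.2)
      (σ.prod volume) := by
    have : Integrable (fun u : ℝ => (Icc (-B) B).indicator (fun _ => M) u) := by
      rw [integrable_indicator_iff measurableSet_Icc]
      exact integrableOn_const (by simp)
    exact this.comp_snd σ
  have hmeas : ∀ q : ℝ × DepthSpace U, AEStronglyMeasurable
      (rescaledJump D a η μ γ V f q.1 q.2) (σ.prod volume) := fun q =>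
    (H.measurable_rescaledJump hD hf (q.2.2.mono hVU) q.1).aestronglyMeasurable
  have hlim : ∀ᵐ p ∂(σ.prod volume), Tendsto (fun q : ℝ × DepthSpace U =>
      rescaledJump D a η μ γ V f q.1 q.2 p) (𝓝[≠] 0 ×ˢ 𝓝 h) (𝓝 (jumpLimit μ γ κ f h p)) := by
    filter_upwards [H.ae_nondegenerate hVU h] with p hp
    exact H.tendsto_rescaledJump hD hVU hf h p.1 hp.1 hp.2
  have hdct := tendsto_integral_filter_of_dominated_convergence
    (bound := fun p : UnitSphere d × ℝ => (Icc (-B) B).indicator (fun _ => M) p.2)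
    (Eventually.of_forall hmeas) (hBM.mono fun q hq => Eventually.of_forall hq) hbi hlim
  -- The limit inherits measurability and the dominating function; its integrability lets Fubini
  -- perform the `u`-integration first.
  have hli : Integrable (jumpLimit μ γ κ f h) (σ.prod volume) := by
    refine hbi.mono' (aestronglyMeasurable_of_tendsto_ae _ hmeas hlim) ?_
    filter_upwards [hlim] with p hp
    exact le_of_tendsto hp.norm (hBM.mono fun q hq => hq p)
  have h0 : ∀ᶠ q : ℝ × DepthSpace U in 𝓝[≠] 0 ×ˢ 𝓝 h, q.1 ≠ 0 :=
    (tendsto_fst (f := 𝓝[≠] (0 : ℝ)) (g := 𝓝 h)).eventually self_mem_nhdsWithin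
  rw [integral_prod _ hli] at hdct
  have he : ∀ n : UnitSphere d, ∫ u, jumpLimit μ γ κ f h (n, u) =
      (f (μ + γ n • (n : Space d)) * (γ n ^ (d - 1) / |κ n|) *
        h (μ + γ n • (n : Space d))) • (μ + γ n • (n : Space d)) := fun n => by
    simp only [jumpLimit]
    rw [integral_smul_const, integral_const_mul, integral_step_sub_step (H.slope_neg n)]
    congr 1
    ring
  simp only [he] at hdct
  refine hdct.congr' ?_
  filter_upwards [hBM, h0] with q hq hq0
  exact (H.integral_jumpIntegrand hD hf hC (q.2.2.mono hVU) hq0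
    (hbi.mono' (hmeas q) (Eventually.of_forall hq))).symm

end Asymptotics

/-! ### Geometry of a single tube around the level set -/

section Tube

variable {d : ℕ} {D : Space d → ℝ} {a δ : ℝ} {μ : Space d} {γ : UnitSphere d → ℝ}

theorem norm_coe_unitSphere (n : UnitSphere d) : ‖(n : Space d)‖ = 1 := by simp

theorem eq_of_smul_eq_smul {r s : ℝ} {n m : UnitSphere d} (hr : 0 < r) (hs : 0 < s)
    (h : r • (n : Space d) = s • (m : Space d)) : r = s ∧ n = m := by
  have h1 : r = s := by
    have := congrArg norm h
    simpa [norm_smul, abs_of_pos hr, abs_of_pos hs] using this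
  subst h1
  exact ⟨rfl, Subtype.ext (smul_right_injective _ hr.ne' h)⟩

/-- `δ` is smaller than every radius, since the depth at the inner end of a ray segment is less
than the depth at the centre. -/
theorem lt_radius_of_lt_center (hD : Continuous D)
    (hanti : ∀ n : UnitSphere d,
      StrictAntiOn (fun lam : ℝ => D (μ + (lam + γ n) • (n : Space d))) (Ioo (-δ) δ))
    (hlt : ∀ n : UnitSphere d, D (μ + (-δ + γ n) • (n : Space d)) < D μ)
    (hδ : 0 < δ) (hγ : ∀ n, 0 < γ n) (n : UnitSphere d) : δ < γ n := by
  by_contra! hle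
  set φ : ℝ → ℝ := fun lam => D (μ + (lam + γ n) • (n : Space d)) with hφ
  have hc : Continuous φ := by fun_prop
  have h0 : φ (-γ n) = D μ := by simp [hφ]
  -- If `γ n ≤ δ`, the ray segment would reach the centre, at parameter `-γ n`. Monotonicity holds
  -- only on the open segment, so the inner end `-δ` is reached by continuity.
  have h1 : φ (-γ n) ≤ φ (-δ) := by
    rcases hle.eq_or_lt with h | h
    · rw [h]
    · refine ge_of_tendsto (hc.continuousWithinAt (s := Ioi (-δ)) (x := -δ)) ?_
      filter_upwards [Ioo_mem_nhdsGT (show -δ < -γ n by linarith)] with x hx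
      exact (hanti n ⟨hx.1, by linarith [hx.2, hγ n]⟩ ⟨by linarith, by linarith [hγ n]⟩ hx.2).le
  rw [h0] at h1
  exact absurd (hlt n) (not_lt.2 h1)

variable (hanti : ∀ n : UnitSphere d,
    StrictAntiOn (fun lam : ℝ => D (μ + (lam + γ n) • (n : Space d))) (Ioo (-δ) δ))

theorem levelShift_spec {p : ℝ × UnitSphere d} (hp : p ∈ polarDomain D δ μ γ) :
    levelShift D δ μ γ p ∈ Ioo (-δ) δ ∧ D (tau D δ μ γ p) = p.1 := by
  have h : ∃ lam ∈ Ioo (-δ) δ, D (μ + (lam + γ p.2) • (p.2 : Space d)) = p.1 := hp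
  rw [tau, levelShift, dif_pos h]
  exact h.choose_spec

include hanti in
theorem levelShift_apply {lam : ℝ} (hl : lam ∈ Ioo (-δ) δ) (n : UnitSphere d) :
    levelShift D δ μ γ (D (μ + (lam + γ n) • (n : Space d)), n) = lam := by
  have hp : (D (μ + (lam + γ n) • (n : Space d)), n) ∈ polarDomain D δ μ γ := ⟨lam, hl, rfl⟩
  obtain ⟨h1, h2⟩ := levelShift_spec hp
  exact (hanti n).injOn h1 hl h2

include hanti in
theorem tau_apply {r : ℝ} {n : UnitSphere d} (hr : r ∈ Ioo (γ n - δ) (γ n + δ)) :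
    tau D δ μ γ (D (μ + r • (n : Space d)), n) = μ + r • (n : Space d) := by
  have h := levelShift_apply hanti (lam := r - γ n)
    ⟨by linarith [hr.1], by linarith [hr.2]⟩ n
  rw [sub_add_cancel] at h
  rw [tau, h, sub_add_cancel]

theorem mem_polarDomain {r : ℝ} {n : UnitSphere d} (hr : r ∈ Ioo (γ n - δ) (γ n + δ)) :
    (D (μ + r • (n : Space d)), n) ∈ polarDomain D δ μ γ :=
  ⟨r - γ n, ⟨by linarith [hr.1], by linarith [hr.2]⟩, by rw [sub_add_cancel]⟩

include hanti in
theorem mem_tauImage {r : ℝ} {n : UnitSphere d} (hr : r ∈ Ioo (γ n - δ) (γ n + δ)) :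
    μ + r • (n : Space d) ∈ tauImage D δ μ γ :=
  ⟨_, mem_polarDomain hr, tau_apply hanti hr⟩

theorem exists_of_mem_tauImage {x : Space d} (hx : x ∈ tauImage D δ μ γ) :
    ∃ n : UnitSphere d, ∃ r ∈ Ioo (γ n - δ) (γ n + δ), x = μ + r • (n : Space d) := by
  obtain ⟨p, hp, rfl⟩ := hx
  obtain ⟨h1, -⟩ := levelShift_spec hp
  exact ⟨p.2, levelShift D δ μ γ p + γ p.2, ⟨by linarith [h1.1], by linarith [h1.2]⟩, rfl⟩

variable (hγ : ∀ n, δ < γ n)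

include hγ in
-- Since `δ < γ`, every point of the tube has a representation with positive radius, and such polar
-- coordinates are unique.
theorem mem_Ioo_of_mem_tauImage {r : ℝ} {n : UnitSphere d} (hr : 0 < r)
    (hx : μ + r • (n : Space d) ∈ tauImage D δ μ γ) : r ∈ Ioo (γ n - δ) (γ n + δ) := by
  obtain ⟨m, s, hs, h⟩ := exists_of_mem_tauImage hx
  have := eq_of_smul_eq_smul hr (by linarith [hs.1, hγ m]) (add_left_cancel h)
  rw [this.1, this.2]
  exact hs

include hanti hγ in
theorem tauInv_apply {r : ℝ} {n : UnitSphere d} (hr : r ∈ Ioo (γ n - δ) (γ n + δ)) :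
    tauInv D δ μ γ (μ + r • (n : Space d)) = (D (μ + r • (n : Space d)), (n : Space d)) := by
  have hinj : Function.Injective fun p : polarDomain D δ μ γ => tau D δ μ γ p.1 := by
    intro p q hpq
    obtain ⟨h1, h1'⟩ := levelShift_spec p.2
    obtain ⟨h2, h2'⟩ := levelShift_spec q.2
    have h3 := eq_of_smul_eq_smul (by linarith [h1.1, hγ p.1.2]) (by linarith [h2.1, hγ q.1.2])
      (add_left_cancel hpq)
    refine Subtype.ext (Prod.ext ?_ h3.2)
    rw [← h1', ← h2']
    exact congrArg D hpq
  have h := hinj.extend_apply (fun p : polarDomain D δ μ γ => (p.1.1, (p.1.2 : Space d))) 0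
    ⟨_, mem_polarDomain (D := D) (μ := μ) hr⟩
  rw [tau_apply hanti hr] at h
  exact h

theorem hasDerivAt_ray (hD : Differentiable ℝ D) (n : UnitSphere d) (r : ℝ) :
    HasDerivAt (fun s : ℝ => D (μ + s • (n : Space d)))
      (fderiv ℝ D (μ + r • (n : Space d)) n) r := by
  have h1 : HasDerivAt (fun s : ℝ => μ + s • (n : Space d)) (n : Space d) r := by
    simpa using ((hasDerivAt_id r).smul_const (n : Space d)).const_add μ
  exact (hD _).hasFDerivAt.comp_hasDerivAt r h1

include hanti in
theorem strictAntiOn_ray (n : UnitSphere d) :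
    StrictAntiOn (fun r : ℝ => D (μ + r • (n : Space d))) (Ioo (γ n - δ) (γ n + δ)) := by
  intro r hr s hs hrs
  have := hanti n (a := r - γ n) (b := s - γ n) ⟨by linarith [hr.1], by linarith [hr.2]⟩
    ⟨by linarith [hs.1], by linarith [hs.2]⟩ (by linarith)
  simpa using this

include hanti hγ in
-- Monotonicity gives `≤ 0`. Along a ray `τ⁻¹` is `s ↦ (D(μ + s n), n)`, with derivative `(D' n,
-- 0)`; were `D' n = 0`, the differential of `τ⁻¹` would kill `n ≠ 0`.
theorem fderiv_ray_neg (hD : Differentiable ℝ D)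
    (hfull : ∀ x ∈ tauImage D δ μ γ, Function.Injective (fderiv ℝ (tauInv D δ μ γ) x))
    {r : ℝ} {n : UnitSphere d} (hr : r ∈ Ioo (γ n - δ) (γ n + δ)) :
    fderiv ℝ D (μ + r • (n : Space d)) n < 0 := by
  have hn0 : (n : Space d) ≠ 0 := by
    rw [← norm_ne_zero_iff, norm_coe_unitSphere]; exact one_ne_zero
  have hnhds : Ioo (γ n - δ) (γ n + δ) ∈ 𝓝 r := isOpen_Ioo.mem_nhds hr
  have hder := hasDerivAt_ray (μ := μ) hD n r
  refine lt_of_le_of_ne ?_ fun h0 => ?_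
  · have h1 := (strictAntiOn_ray hanti n).antitoneOn.derivWithin_nonpos (x := r)
    rwa [derivWithin_of_mem_nhds hnhds, hder.deriv] at h1
  · have hx := mem_tauImage hanti hr
    have hinj := hfull _ hx
    by_cases hdiff : DifferentiableAt ℝ (tauInv D δ μ γ) (μ + r • (n : Space d))
    · have h1 : HasDerivAt (fun s : ℝ => μ + s • (n : Space d)) (n : Space d) r := by
        simpa using ((hasDerivAt_id r).smul_const (n : Space d)).const_add μ
      have h2 := hdiff.hasFDerivAt.comp_hasDerivAt r h1
      have h3 : HasDerivAt (fun s : ℝ => (D (μ + s • (n : Space d)), (n : Space d)))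
          (fderiv ℝ D (μ + r • (n : Space d)) n, 0) r := hder.prodMk (hasDerivAt_const _ _)
      have h4 : (tauInv D δ μ γ ∘ fun s : ℝ => μ + s • (n : Space d)) =ᶠ[𝓝 r]
          fun s : ℝ => (D (μ + s • (n : Space d)), (n : Space d)) := by
        filter_upwards [hnhds] with s hs using tauInv_apply hanti hγ hs
      have h5 := (h3.congr_of_eventuallyEq h4).unique h2
      rw [h0] at h5
      exact hn0 (hinj (h5.symm.trans (map_zero _).symm))
    -- At a point of non-differentiability `fderiv` takes the default value `0`, which is not
    -- injective, so full rank already excludes this case.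
    · rw [fderiv_zero_of_not_differentiableAt hdiff] at hinj
      exact hn0 (hinj (by simp))

include hanti hγ in
-- `D` exceeds `a` just inside the radius `γ n` and is below `a` just outside, and this persists for
-- nearby directions `m`. The intermediate value theorem gives a crossing near `γ n` on the ray of
-- `m`; openness puts it in the tube, where the crossing is unique and hence is `γ m`.
theorem continuous_radius_of_isOpen (hδ : 0 < δ) (hD : Continuous D)
    (hlevel : ∀ n : UnitSphere d, D (μ + γ n • (n : Space d)) = a)
    (hopen : IsOpen (tauImage D δ μ γ)) : Continuous γ := by
  rw [continuous_iff_continuousAt]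
  intro n
  have hγn : γ n ∈ Ioo (γ n - δ) (γ n + δ) := ⟨by linarith, by linarith⟩
  obtain ⟨ρ, hρ, hball⟩ := Metric.isOpen_iff.1 hopen _ (mem_tauImage hanti hγn)
  rw [Metric.continuousAt_iff']
  intro e' he'
  -- The bound `δ / 2` keeps `γ n ± e` in the ray segment and the crossing radius positive. Half of
  -- `ρ` is reserved for the change of radius, the other half for the change of direction.
  set e := min (min (e' / 2) (δ / 2)) (ρ / 2)
  have he : 0 < e := by positivity
  have he1 : e ≤ e' / 2 := (min_le_left _ _).trans (min_le_left _ _)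
  have he2 : e ≤ δ / 2 := (min_le_left _ _).trans (min_le_right _ _)
  have he3 : e ≤ ρ / 2 := min_le_right _ _
  have hlo : a < D (μ + (γ n - e) • (n : Space d)) := by
    rw [← hlevel n]
    exact strictAntiOn_ray hanti n ⟨by linarith, by linarith⟩ hγn (by linarith)
  have hhi : D (μ + (γ n + e) • (n : Space d)) < a := by
    rw [← hlevel n]
    exact strictAntiOn_ray hanti n hγn ⟨by linarith, by linarith⟩ (by linarith)
  have hc : ∀ s : ℝ, Continuous fun m : UnitSphere d => D (μ + s • (m : Space d)) := fun s => by
    fun_prop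
  have hdist : ∀ᶠ m : UnitSphere d in 𝓝 n, (γ n + e) * ‖(m : Space d) - n‖ < ρ / 2 := by
    have : Continuous fun m : UnitSphere d => (γ n + e) * ‖(m : Space d) - n‖ := by fun_prop
    refine this.continuousAt.eventually (gt_mem_nhds ?_)
    simpa using hρ
  filter_upwards [(hc _).continuousAt.eventually (lt_mem_nhds hlo),
    (hc _).continuousAt.eventually (gt_mem_nhds hhi), hdist] with m hm1 hm2 hm3
  have hcm : ContinuousOn (fun s : ℝ => D (μ + s • (m : Space d))) (Icc (γ n - e) (γ n + e)) :=
    Continuous.continuousOn (by fun_prop)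
  obtain ⟨r, hr, hra⟩ := intermediate_value_Icc' (by linarith) hcm ⟨hm2.le, hm1.le⟩
  have hr0 : 0 < r := by linarith [hr.1, hγ n]
  have hrm : μ + r • (m : Space d) ∈ tauImage D δ μ γ := by
    refine hball ?_
    rw [Metric.mem_ball, dist_eq_norm]
    have h1 : μ + r • (m : Space d) - (μ + γ n • (n : Space d)) =
        r • ((m : Space d) - n) + (r - γ n) • (n : Space d) := by module
    rw [h1]
    refine (norm_add_le _ _).trans_lt ?_
    rw [norm_smul, norm_smul, norm_coe_unitSphere, Real.norm_eq_abs, Real.norm_eq_abs,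
      abs_of_pos hr0, mul_one]
    have h2 : |r - γ n| ≤ e := abs_le.2 ⟨by linarith [hr.1], by linarith [hr.2]⟩
    have h3 : r * ‖(m : Space d) - n‖ ≤ (γ n + e) * ‖(m : Space d) - n‖ := by
      gcongr; exact hr.2
    linarith
  have hrm' := mem_Ioo_of_mem_tauImage hγ hr0 hrm
  have hreq : r = γ m := (strictAntiOn_ray hanti m).injOn hrm'
    ⟨by linarith, by linarith⟩ (hra.trans (hlevel m).symm)
  rw [← hreq, Real.dist_eq, abs_lt]
  exact ⟨by linarith [hr.1], by linarith [hr.2]⟩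

include hanti hγ in
-- The function `x ↦ D'(x)(x - μ)`, which is `r D'(x) n` in polar coordinates, is continuous and
-- negative on the compact band, hence bounded away from `0`; dividing by the bounded radius bounds
-- the slope. In the mean value theorem between `r` and `γ n`, monotonicity along the ray keeps the
-- intermediate point in the band.
theorem exists_radial_bound {η : ℝ} (hδ : 0 < δ) (hD : ContDiff ℝ 1 D)
    (hlevel : ∀ n : UnitSphere d, D (μ + γ n • (n : Space d)) = a)
    (hfull : ∀ x ∈ tauImage D δ μ γ, Function.Injective (fderiv ℝ (tauInv D δ μ γ) x))
    (hcomp : IsCompact (tauImage D δ μ γ ∩ {t | |D t - a| ≤ η})) :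
    ∃ c > 0, ∀ (n : UnitSphere d) (r : ℝ), 0 < r → μ + r • (n : Space d) ∈ tauImage D δ μ γ →
      |D (μ + r • (n : Space d)) - a| ≤ η → c * |r - γ n| ≤ |D (μ + r • (n : Space d)) - a| := by
  set Z := tauImage D δ μ γ ∩ {t | |D t - a| ≤ η}
  have hdiff : Differentiable ℝ D := hD.differentiable one_ne_zero
  have hψc : Continuous fun x => fderiv ℝ D x (x - μ) :=
    (hD.continuous_fderiv one_ne_zero).clm_apply (by fun_prop)
  have hψ : ∀ x ∈ Z, fderiv ℝ D x (x - μ) < 0 := by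
    intro x hx
    obtain ⟨n, r, hr, rfl⟩ := exists_of_mem_tauImage hx.1
    rw [add_sub_cancel_left, map_smul, smul_eq_mul]
    exact mul_neg_of_pos_of_neg (by linarith [hr.1, hγ n])
      (fderiv_ray_neg hanti hγ hdiff hfull hr)
  obtain ⟨c', hc', hψb⟩ : ∃ c' > 0, ∀ x ∈ Z, fderiv ℝ D x (x - μ) ≤ -c' := by
    rcases Z.eq_empty_or_nonempty with h | h
    · exact ⟨1, one_pos, by simp [h]⟩
    · obtain ⟨x, hx, hmax⟩ := hcomp.exists_isMaxOn h hψc.continuousOn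
      exact ⟨-fderiv ℝ D x (x - μ), by linarith [hψ x hx], fun y hy => by
        simpa using hmax hy⟩
  obtain ⟨R, hR0, hR⟩ : ∃ R > 0, ∀ x ∈ Z, ‖x - μ‖ ≤ R := by
    obtain ⟨R, hR0, hR⟩ := hcomp.isBounded.exists_pos_norm_le
    refine ⟨R + ‖μ‖, by positivity, fun x hx => (norm_sub_le _ _).trans ?_⟩
    gcongr
    exact hR x hx
  have hslope : ∀ (n : UnitSphere d) (s : ℝ), s ∈ Ioo (γ n - δ) (γ n + δ) →
      |D (μ + s • (n : Space d)) - a| ≤ η → fderiv ℝ D (μ + s • (n : Space d)) n ≤ -(c' / R) := by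
    intro n s hs hsη
    have hs0 : 0 < s := by linarith [hs.1, hγ n]
    have hm : μ + s • (n : Space d) ∈ Z := ⟨mem_tauImage hanti hs, hsη⟩
    have h1 := hψb _ hm
    have h2 := hR _ hm
    rw [add_sub_cancel_left] at h1 h2
    rw [map_smul, smul_eq_mul] at h1
    rw [norm_smul, norm_coe_unitSphere, mul_one, Real.norm_of_nonneg hs0.le] at h2
    have h3 := fderiv_ray_neg hanti hγ hdiff hfull hs
    rw [le_neg, div_le_iff₀ hR0]
    nlinarith
  refine ⟨c' / R, by positivity, fun n r hr hrV hrη => ?_⟩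
  have hrI := mem_Ioo_of_mem_tauImage hγ hr hrV
  have hγI : γ n ∈ Ioo (γ n - δ) (γ n + δ) := ⟨by linarith, by linarith⟩
  have hcont : ∀ s t : ℝ, ContinuousOn (fun s : ℝ => D (μ + s • (n : Space d))) (Icc s t) :=
    fun s t => by
      have := hD.continuous
      exact Continuous.continuousOn (by fun_prop)
  have hanti' := (strictAntiOn_ray hanti n).antitoneOn
  have hla := hlevel n
  rcases lt_trichotomy r (γ n) with h | h | h
  · obtain ⟨s, hs, hse⟩ := exists_hasDerivAt_eq_slope _ _ h (hcont _ _)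
      fun s _ => hasDerivAt_ray (μ := μ) hdiff n s
    have hsI : s ∈ Ioo (γ n - δ) (γ n + δ) := ⟨hrI.1.trans hs.1, hs.2.trans hγI.2⟩
    have h1 : D (μ + γ n • (n : Space d)) ≤ D (μ + s • (n : Space d)) := hanti' hsI hγI hs.2.le
    have h2 : D (μ + s • (n : Space d)) ≤ D (μ + r • (n : Space d)) := hanti' hrI hsI hs.1.le
    rw [hla] at h1
    rw [abs_of_nonneg (sub_nonneg.2 (h1.trans h2))] at hrη ⊢
    have h3 := hslope n s hsI (by rw [abs_of_nonneg (sub_nonneg.2 h1)]; linarith)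
    rw [hse, hla, div_le_iff₀ (sub_pos.2 h)] at h3
    rw [abs_of_neg (sub_neg.2 h)]
    linarith
  · rw [h, sub_self, abs_zero, mul_zero]
    exact abs_nonneg _
  · obtain ⟨s, hs, hse⟩ := exists_hasDerivAt_eq_slope _ _ h (hcont _ _)
      fun s _ => hasDerivAt_ray (μ := μ) hdiff n s
    have hsI : s ∈ Ioo (γ n - δ) (γ n + δ) := ⟨hγI.1.trans hs.1, hs.2.trans hrI.2⟩
    have h1 : D (μ + s • (n : Space d)) ≤ D (μ + γ n • (n : Space d)) := hanti' hγI hsI hs.1.le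
    have h2 : D (μ + r • (n : Space d)) ≤ D (μ + s • (n : Space d)) := hanti' hsI hrI hs.2.le
    rw [hla] at h1
    rw [abs_of_nonpos (sub_nonpos.2 (h2.trans h1))] at hrη ⊢
    have h3 := hslope n s hsI (by rw [abs_of_nonpos (sub_nonpos.2 h1)]; linarith)
    rw [hse, hla, div_le_iff₀ (sub_pos.2 h)] at h3
    rw [abs_of_pos (sub_pos.2 h)]
    linarith

include hanti hγ in
theorem radialChart_tauImage {η : ℝ} (hη : 0 < η) (hδ : 0 < δ) (hD : ContDiff ℝ 1 D)
    (hlevel : ∀ n : UnitSphere d, D (μ + γ n • (n : Space d)) = a)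
    (hopen : IsOpen (tauImage D δ μ γ))
    (hfull : ∀ x ∈ tauImage D δ μ γ, Function.Injective (fderiv ℝ (tauInv D δ μ γ) x))
    (hcomp : IsCompact (tauImage D δ μ γ ∩ {t | |D t - a| ≤ η})) :
    RadialChart D a η μ γ (fun n => fderiv ℝ D (μ + γ n • (n : Space d)) n)
      (tauImage D δ μ γ) := by
  have hdiff : Differentiable ℝ D := hD.differentiable one_ne_zero
  have hγc := continuous_radius_of_isOpen hanti hγ hδ hD.continuous hlevel hopen
  have hγI : ∀ n, γ n ∈ Ioo (γ n - δ) (γ n + δ) := fun n => ⟨by linarith, by linarith⟩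
  exact
  { eta_pos := hη
    isOpen := hopen
    isBounded := by
      obtain ⟨R, hR⟩ := (isCompact_range hγc).isBounded.exists_norm_le
      refine isBounded_iff_forall_norm_le.2 ⟨‖μ‖ + (R + δ), fun x hx => ?_⟩
      obtain ⟨n, r, hr, rfl⟩ := exists_of_mem_tauImage hx
      refine (norm_add_le _ _).trans ?_
      have h1 := (le_abs_self _).trans (hR _ ⟨n, rfl⟩)
      rw [norm_smul, norm_coe_unitSphere, mul_one,
        Real.norm_of_nonneg (by linarith [hr.1, hγ n])]
      linarith [hr.2]
    continuous_radius := hγc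
    radius_pos := fun n => hδ.trans (hγ n)
    continuous_slope := by
      refine ((hD.continuous_fderiv one_ne_zero).comp ?_).clm_apply continuous_subtype_val
      exact continuous_const.add (hγc.smul continuous_subtype_val)
    slope_neg := fun n => fderiv_ray_neg hanti hγ hdiff hfull (hγI n)
    mem := fun n => mem_tauImage hanti (hγI n)
    level := hlevel
    hasDerivAt := fun n => hasDerivAt_ray hdiff n _
    exists_bound := exists_radial_bound hanti hγ hδ hD hlevel hfull hcomp }

end Tube

/-! ### The Jacobian of the map `τ` -/

section Jacobian

variable {d : ℕ} {D : Space d → ℝ} {a δ : ℝ} {μ : Space d} {γ : UnitSphere d → ℝ}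

/-- A left inverse of `x ↦ τ (a + ⟪n, x⟫, sphereParam n x)`. -/
noncomputable def flatten (D : Space d → ℝ) (a : ℝ) (μ : Space d) (n : UnitSphere d)
    (y : Space d) : Space d :=
  (D y - a) • (n : Space d) + ((inner ℝ (n : Space d) (y - μ))⁻¹ • (y - μ) - (n : Space d))

theorem inner_self_unitSphere (n : UnitSphere d) : inner ℝ (n : Space d) (n : Space d) = 1 := by
  rw [real_inner_self_eq_norm_sq, norm_coe_unitSphere, one_pow]

/-- The differential of `flatten` at `μ + γ n`. -/
noncomputable def flattenDeriv (D' : Space d →L[ℝ] ℝ) (r : ℝ) (n : UnitSphere d) :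
    Space d →L[ℝ] Space d :=
  r⁻¹ • (ContinuousLinearMap.id ℝ (Space d) +
    (r • D' - innerSL ℝ (n : Space d)).smulRight (n : Space d))

theorem hasStrictFDerivAt_flatten (hD : ContDiff ℝ 1 D) (n : UnitSphere d) {r : ℝ} (hr : 0 < r) :
    HasStrictFDerivAt (flatten D a μ n)
      (flattenDeriv (fderiv ℝ D (μ + r • (n : Space d))) r n) (μ + r • (n : Space d)) := by
  set x₀ : Space d := μ + r • (n : Space d) with hx₀
  have hi : inner ℝ (n : Space d) (x₀ - μ) = r := by
    rw [hx₀, add_sub_cancel_left, inner_smul_right, inner_self_unitSphere, mul_one]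
  have h1 : HasStrictFDerivAt D (fderiv ℝ D x₀) x₀ :=
    hD.contDiffAt.hasStrictFDerivAt one_ne_zero
  have h2 : HasStrictFDerivAt (fun y : Space d => y - μ) (ContinuousLinearMap.id ℝ (Space d)) x₀ :=
    (hasStrictFDerivAt_id x₀).sub_const μ
  have h3 : HasStrictFDerivAt (fun y : Space d => inner ℝ (n : Space d) (y - μ))
      (innerSL ℝ (n : Space d)) x₀ := by
    simpa using (innerSL ℝ (n : Space d)).hasStrictFDerivAt.comp x₀ h2
  have h4 := (hasStrictDerivAt_inv (x := inner ℝ (n : Space d) (x₀ - μ))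
    (by rw [hi]; exact hr.ne')).comp_hasStrictFDerivAt x₀ h3
  have h5 := ((h1.sub_const a).smul_const (n : Space d)).add
    ((h4.smul h2).sub_const (n : Space d))
  refine h5.congr_fderiv ?_
  ext1 v
  simp only [flattenDeriv, Function.comp_apply, hi]
  have hv : x₀ - μ = r • (n : Space d) := by rw [hx₀, add_sub_cancel_left]
  simp only [add_apply, smul_apply,
    ContinuousLinearMap.smulRight_apply, ContinuousLinearMap.id_apply,
    sub_apply, innerSL_apply_apply, hv, smul_eq_mul]
  match_scalars <;> field_simp
  ring

/-- Up to the scalar `r⁻¹` this is a rank-one perturbation of the identity, with determinant `1 + (r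
D' n - ⟪n, n⟫) = r D' n`. -/
theorem det_flattenDeriv (D' : Space d →L[ℝ] ℝ) {r : ℝ} (n : UnitSphere d) :
    (flattenDeriv D' r n).det = r⁻¹ ^ d * (r * D' n) := by
  have h : ((flattenDeriv D' r n : Space d →L[ℝ] Space d) : Space d →ₗ[ℝ] Space d) =
      r⁻¹ • LinearMap.transvection ((r • D' - innerSL ℝ (n : Space d) : Space d →L[ℝ] ℝ) :
        Space d →ₗ[ℝ] ℝ) (n : Space d) := by
    ext1 v
    simp [flattenDeriv, LinearMap.transvection]
  rw [ContinuousLinearMap.det, h, LinearMap.det_smul, LinearMap.transvection.det]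
  simp

theorem pos_dim (n : UnitSphere d) : 0 < d := by
  rcases Nat.eq_zero_or_pos d with rfl | h
  · have h1 := norm_coe_unitSphere n
    rw [Subsingleton.elim (n : Space 0) 0, norm_zero] at h1
    exact absurd h1 zero_ne_one
  · exact h

theorem sphereParam_eq {n m : UnitSphere d} {x : Space d} {c : ℝ} (hc : 0 < c)
    (h : (n : Space d) + (x - inner ℝ (n : Space d) x • (n : Space d)) = c • (m : Space d)) :
    sphereParam n x = m := by
  refine Subtype.ext ?_
  simp only [sphereParam]
  rw [h, norm_smul, norm_coe_unitSphere, mul_one, Real.norm_of_nonneg hc.le, smul_smul,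
    inv_mul_cancel₀ hc.ne', one_smul]

/-- The map `flatten` records `D - a` along `n` and projects centrally onto the tangent plane at
`n`. Its local inverse agrees near `0` with the parametrized `τ`, so the Jacobian is the reciprocal
of the determinant of `flattenDeriv`. -/
theorem absJacobian_tau
    (hanti : ∀ n : UnitSphere d,
      StrictAntiOn (fun lam : ℝ => D (μ + (lam + γ n) • (n : Space d))) (Ioo (-δ) δ))
    (hγ : ∀ n, δ < γ n) (hδ : 0 < δ) (hD : ContDiff ℝ 1 D)
    (hlevel : ∀ n : UnitSphere d, D (μ + γ n • (n : Space d)) = a)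
    (hopen : IsOpen (tauImage D δ μ γ))
    (hfull : ∀ x ∈ tauImage D δ μ γ, Function.Injective (fderiv ℝ (tauInv D δ μ γ) x))
    (n : UnitSphere d) :
    absJacobian (tau D δ μ γ) a n =
      γ n ^ (d - 1) / |fderiv ℝ D (μ + γ n • (n : Space d)) n| := by
  have hγn : γ n ∈ Ioo (γ n - δ) (γ n + δ) := ⟨by linarith, by linarith⟩
  have hγ0 : 0 < γ n := hδ.trans (hγ n)
  set x₀ : Space d := μ + γ n • (n : Space d) with hx₀
  have hκ : fderiv ℝ D x₀ n < 0 :=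
    fderiv_ray_neg hanti hγ (hD.differentiable one_ne_zero) hfull hγn
  have hdet := det_flattenDeriv (fderiv ℝ D x₀) (r := γ n) n
  have hdet0 : (flattenDeriv (fderiv ℝ D x₀) (γ n) n).det ≠ 0 := by
    rw [hdet]
    have := hκ.ne
    positivity
  set e := ContinuousLinearMap.toContinuousLinearEquivOfDetNeZero _ hdet0 with he
  have hstrict : HasStrictFDerivAt (flatten D a μ n) (e : Space d →L[ℝ] Space d) x₀ :=
    hasStrictFDerivAt_flatten hD n hγ0
  have hi : inner ℝ (n : Space d) (x₀ - μ) = γ n := by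
    rw [hx₀, add_sub_cancel_left, inner_smul_right, inner_self_unitSphere, mul_one]
  have hF0 : flatten D a μ n x₀ = 0 := by
    rw [flatten, hi, hx₀, add_sub_cancel_left, smul_smul, inv_mul_cancel₀ hγ0.ne', hlevel]
    simp
  have hG := hstrict.to_localInverse
  have hGt := hstrict.localInverse_tendsto
  have hGr := hstrict.eventually_right_inverse
  rw [hF0] at hG hGt hGr
  have hipos : ∀ᶠ y in 𝓝 x₀, 0 < inner ℝ (n : Space d) (y - μ) := by
    have : Continuous fun y : Space d => inner ℝ (n : Space d) (y - μ) := by fun_prop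
    exact this.continuousAt.eventually (lt_mem_nhds (hγ0.trans_eq hi.symm))
  have heq : (fun x : Space d => tau D δ μ γ (a + inner ℝ (n : Space d) x, sphereParam n x))
      =ᶠ[𝓝 0] hstrict.localInverse (flatten D a μ n) e x₀ := by
    filter_upwards [hGt.eventually (hopen.mem_nhds (mem_tauImage hanti hγn)),
      hGt.eventually hipos, hGr] with x hxV hxi hxr
    obtain ⟨m, r, hr, hy⟩ := exists_of_mem_tauImage hxV
    set y := hstrict.localInverse (flatten D a μ n) e x₀ x
    rw [flatten] at hxr
    -- The tangential part of `flatten` is orthogonal to `n`, so pairing with `n` recovers the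
    -- level; what remains of `x`, added to `n`, is a positive multiple of `y - μ` and recovers the
    -- direction.
    have h1 : inner ℝ (n : Space d) x = D y - a := by
      rw [← hxr, inner_add_right, inner_sub_right, inner_smul_right, inner_smul_right,
        inner_self_unitSphere, inv_mul_cancel₀ hxi.ne']
      ring
    have hr0 : 0 < r := by linarith [hr.1, hγ m]
    have h2 : sphereParam n x = m := by
      refine sphereParam_eq (c := (inner ℝ (n : Space d) (y - μ))⁻¹ * r) (by positivity) ?_
      rw [h1, mul_smul]
      have h3 : r • (m : Space d) = y - μ := by rw [hy, add_sub_cancel_left]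
      rw [h3]
      nth_rewrite 1 [← hxr]
      module
    rw [h1, h2, add_sub_cancel, hy]
    exact tau_apply hanti hr
  have hfd : fderiv ℝ (fun x : Space d =>
      tau D δ μ γ (a + inner ℝ (n : Space d) x, sphereParam n x)) 0 = e.symm :=
    (hG.hasFDerivAt.congr_of_eventuallyEq heq).fderiv
  have hed : (e : Space d →L[ℝ] Space d) = flattenDeriv (fderiv ℝ D x₀) (γ n) n := rfl
  rw [absJacobian, hfd, ContinuousLinearEquiv.det_coe_symm, hed, hdet, abs_inv, abs_mul, abs_mul,
    abs_of_pos hγ0, abs_of_pos (by positivity)]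
  have hpow : γ n ^ d = γ n ^ (d - 1) * γ n := by
    rw [← pow_succ, Nat.sub_add_cancel (pos_dim n)]
  have := abs_pos.2 hκ.ne
  rw [inv_pow, hpow]
  field_simp

end Jacobian

/-! ### Assembling the charts: the limit of the difference quotient -/

section Global

variable {d l : ℕ} {U : Set (Space d)} {D : DepthSpace U} {a η : ℝ} {μ : Fin l → Space d}
  {γ κ : Fin l → UnitSphere d → ℝ} {V : Fin l → Set (Space d)} {A : Set (Space d)}

/-- The level set `{D = a}` has a neighbourhood `{|D - a| < η}` that is covered by finitely many
disjoint radial charts inside `U`, and `{D ≥ a - η}` is a compact subset of `U`. -/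
structure TransversalLevel (D : DepthSpace U) (a η : ℝ) (μ : Fin l → Space d)
    (γ κ : Fin l → UnitSphere d → ℝ) (V : Fin l → Set (Space d)) : Prop where
  eta_pos : 0 < η
  continuous : Continuous (D : Space d → ℝ)
  chart : ∀ i, RadialChart D a η (μ i) (γ i) (κ i) (V i)
  disjoint : ∀ i j, i ≠ j → Disjoint (V i) (V j)
  cover : {t | |D t - a| < η} ⊆ ⋃ i, V i
  isOpen : IsOpen U
  image_subset : ∀ i, V i ⊆ U
  isCompact : IsCompact {t | a - η ≤ D t}
  superlevel_subset : {t | a - η ≤ D t} ⊆ U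

theorem abs_density_le_norm (g : DensitySpace U) (t : Space d) : |g t| ≤ ‖g‖ :=
  lp.norm_apply_le_norm ENNReal.top_ne_zero (g : BddFun d) t

theorem integrable_indicator_density (g : DensitySpace U) {B : Set (Space d)}
    (hB : MeasurableSet B) (hb : Bornology.IsBounded B) :
    Integrable (B.indicator fun t => g t • t) := by
  obtain ⟨R, hR⟩ := hb.exists_norm_le
  have hg : Integrable (g : Space d → ℝ) := g.2.2
  rw [integrable_indicator_iff hB]
  refine (hg.norm.const_mul R).integrableOn.mono'
    (hg.1.smul aestronglyMeasurable_id).restrict ?_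
  filter_upwards [ae_restrict_mem hB] with t ht
  rw [norm_smul, mul_comm]
  gcongr
  exact hR t ht

theorem indicator_eq_step_smul (a : ℝ) (w g : Space d → ℝ) :
    (indicator {t | a < w t} fun t => g t • t) = fun t => (step a (w t) * g t) • t := by
  ext1 t
  by_cases h : a < w t <;> simp [step, h]

/-- A function of `𝒟` may be non-measurable off `U`. Closeness to `D` confines `{y > a}` to a
compact subset of `U`, where `y` is continuous, so this set is open and bounded. -/
theorem TransversalLevel.integrable_superlevel (H : TransversalLevel D a η μ γ κ V)
    (g : DensitySpace U) (y : DepthSpace U) (hy : ∀ t, |y t - D t| ≤ η) :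
    Integrable (indicator {t | a < y t} fun t => g t • t) := by
  have hsub : {t | a < y t} ⊆ {t | a - η ≤ D t} := fun t ht => by
    have := (abs_le.1 (hy t)).2
    have ht : a < y t := ht
    show a - η ≤ D t
    linarith
  have ho : IsOpen (U ∩ {t | a < y t}) := y.2.isOpen_inter_preimage H.isOpen isOpen_Ioi
  rw [inter_eq_self_of_subset_right (hsub.trans H.superlevel_subset)] at ho
  exact integrable_indicator_density g ho.measurableSet (H.isCompact.isBounded.subset hsub)

theorem TransversalLevel.volume_level_eq_zero [Nontrivial (Space d)]
    (H : TransversalLevel D a η μ γ κ V) : volume {t | D t = a} = 0 := by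
  refine measure_mono_null (t := ⋃ i, V i ∩ {t | D t = a}) (fun t ht => ?_)
    (measure_iUnion_null fun i => (H.chart i).volume_level_eq_zero H.continuous)
  have ht' : D t = a := ht
  obtain ⟨i, hi⟩ := mem_iUnion.1 (H.cover (show |D t - a| < η by simp [ht', H.eta_pos]))
  exact mem_iUnion.2 ⟨i, hi, ht⟩

theorem eventually_small (h : DepthSpace U × DensitySpace U) (hη : 0 < η) :
    ∀ᶠ q : ℝ × DepthSpace U × DensitySpace U in 𝓝[≠] 0 ×ˢ 𝓝 h,
      q.1 ≠ 0 ∧ ‖q.1 • q.2.1‖ < η ∧ ‖q.2.2‖ < ‖h.2‖ + 1 := by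
  have h1 : Tendsto (fun q : ℝ × DepthSpace U × DensitySpace U => q.1)
      (𝓝[≠] 0 ×ˢ 𝓝 h) (𝓝[≠] 0) := tendsto_fst
  have h2 : Tendsto (fun q : ℝ × DepthSpace U × DensitySpace U => q.2)
      (𝓝[≠] 0 ×ˢ 𝓝 h) (𝓝 h) := tendsto_snd
  have h3 : Tendsto (fun q : ℝ × DepthSpace U × DensitySpace U => q.1 • q.2.1)
      (𝓝[≠] 0 ×ˢ 𝓝 h) (𝓝 0) := by
    simpa using (h1.mono_right nhdsWithin_le_nhds).smul h2.fst_nhds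
  have h4 := h3.norm.eventually (gt_mem_nhds (by simpa using hη))
  have h5 := h2.snd_nhds.norm.eventually (gt_mem_nhds (lt_add_one ‖h.2‖))
  filter_upwards [h1.eventually self_mem_nhdsWithin, h4, h5] with q hq1 hq2 hq3
  exact ⟨hq1, hq2, hq3⟩

/-- At every point with `D t ≠ a` the indicator is eventually constant, and the exceptional set is
null; this is also why `>` becomes `≥` in the limit. -/
theorem TransversalLevel.tendsto_mass [Nontrivial (Space d)]
    (H : TransversalLevel D a η μ γ κ V) (h : DepthSpace U × DensitySpace U) :
    Tendsto (fun q : ℝ × DepthSpace U × DensitySpace U =>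
        trimmed a A (D + q.1 • q.2.1 : DepthSpace U) q.2.2)
      (𝓝[≠] 0 ×ˢ 𝓝 h) (𝓝 (∫ t in A, indicator {t | a ≤ D t} (fun t => h.2 t • t) t)) := by
  obtain ⟨R, hR⟩ := H.isCompact.isBounded.exists_norm_le
  have hmS : MeasurableSet {t | a - η ≤ D t} := H.isCompact.measurableSet
  have hint : ∀ q : ℝ × DepthSpace U × DensitySpace U, ‖q.1 • q.2.1‖ < η →
      Integrable (indicator {t | a < (D + q.1 • q.2.1) t} fun t => q.2.2 t • t) := fun q hq => by
    refine H.integrable_superlevel q.2.2 _ fun t => ?_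
    have := abs_apply_le_norm (q.1 • q.2.1) t
    have h2 : (D + q.1 • q.2.1) t - D t = (q.1 • q.2.1) t := add_sub_cancel_left (D t) _
    rw [h2]
    linarith
  refine tendsto_integral_filter_of_dominated_convergence
    ({t | a - η ≤ D t}.indicator fun _ => (‖h.2‖ + 1) * R) ?_ ?_ ?_ ?_
  · filter_upwards [eventually_small h H.eta_pos] with q hq
    exact (hint q hq.2.1).1.restrict
  · filter_upwards [eventually_small h H.eta_pos] with q hq
    refine Eventually.of_forall fun t => ?_
    by_cases ht : a < (D + q.1 • q.2.1) t
    · have h1 := abs_apply_le_norm (q.1 • q.2.1) t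
      have h2 : (D + q.1 • q.2.1) t = D t + (q.1 • q.2.1) t := rfl
      have h3 : t ∈ {t | a - η ≤ D t} := by
        have := le_abs_self ((q.1 • q.2.1) t)
        show a - η ≤ D t
        linarith
      rw [indicator_of_mem (show t ∈ {t | a < (D + q.1 • q.2.1) t} from ht), indicator_of_mem h3,
        norm_smul]
      gcongr
      · exact (abs_density_le_norm q.2.2 t).trans hq.2.2.le
      · exact hR t h3
    · rw [indicator_of_notMem (show t ∉ {t | a < (D + q.1 • q.2.1) t} from ht), norm_zero]
      refine indicator_nonneg (fun t ht => ?_) t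
      have := (norm_nonneg t).trans (hR t ht)
      positivity
  · refine Integrable.restrict ?_
    rw [integrable_indicator_iff hmS]
    exact integrableOn_const H.isCompact.measure_lt_top.ne
  · have hne : ∀ᵐ t ∂(volume : Measure (Space d)), D t ≠ a :=
      measure_eq_zero_iff_ae_notMem.1 H.volume_level_eq_zero
    filter_upwards [ae_restrict_of_ae hne] with t ht
    have hq : Tendsto (fun q : ℝ × DepthSpace U × DensitySpace U => q.2)
      (𝓝[≠] 0 ×ˢ 𝓝 h) (𝓝 h) := tendsto_snd
    have hε : Tendsto (fun q : ℝ × DepthSpace U × DensitySpace U => q.1)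
      (𝓝[≠] 0 ×ˢ 𝓝 h) (𝓝 0) := tendsto_fst.mono_right nhdsWithin_le_nhds
    have hg : Tendsto (fun q : ℝ × DepthSpace U × DensitySpace U => q.2.2 t)
        (𝓝[≠] 0 ×ˢ 𝓝 h) (𝓝 (h.2 t)) := by
      rw [tendsto_iff_norm_sub_tendsto_zero]
      refine squeeze_zero (fun _ => norm_nonneg _) (fun q => ?_)
        (tendsto_iff_norm_sub_tendsto_zero.1 hq.snd_nhds)
      exact abs_density_le_norm (q.2.2 - h.2) t
    have hy : Tendsto (fun q : ℝ × DepthSpace U × DensitySpace U => (D + q.1 • q.2.1) t)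
        (𝓝[≠] 0 ×ˢ 𝓝 h) (𝓝 (D t)) := by
      have h3 : Tendsto (fun q : ℝ × DepthSpace U × DensitySpace U => q.1 • q.2.1)
          (𝓝[≠] 0 ×ˢ 𝓝 h) (𝓝 0) := by simpa using hε.smul hq.fst_nhds
      rw [tendsto_iff_norm_sub_tendsto_zero]
      refine squeeze_zero (fun _ => norm_nonneg _) (fun q => ?_)
        (tendsto_zero_iff_norm_tendsto_zero.1 h3)
      have h2 : (D + q.1 • q.2.1) t - D t = (q.1 • q.2.1) t := add_sub_cancel_left (D t) _
      rw [h2]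
      exact abs_apply_le_norm _ t
    rcases lt_or_gt_of_ne ht with hlt | hlt
    · rw [indicator_of_notMem (show t ∉ {t | a ≤ D t} from not_le.2 hlt)]
      refine tendsto_const_nhds.congr' ?_
      filter_upwards [hy.eventually (gt_mem_nhds hlt)] with q hq
      rw [indicator_of_notMem (show t ∉ {t | a < (D + q.1 • q.2.1) t} from hq.not_gt)]
    · rw [indicator_of_mem (show t ∈ {t | a ≤ D t} from hlt.le)]
      refine (hg.smul_const t).congr' ?_
      filter_upwards [hy.eventually (lt_mem_nhds hlt)] with q hq
      rw [indicator_of_mem (show t ∈ {t | a < (D + q.1 • q.2.1) t} from hq)]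

/-- Near the level set the jump of the superlevel set is the sum of the jumps in the charts. -/
theorem TransversalLevel.jump_eq_sum (H : TransversalLevel D a η μ γ κ V) (f : Space d → ℝ)
    {v : Space d → ℝ} (hv : ∀ t, |v t| < η) (t : Space d) :
    ((step a (D t + v t) - step a (D t)) * f t) • t =
      ∑ i, jumpIntegrand D a η (V i) f v t := by
  by_cases hs : step a (D t + v t) - step a (D t) = 0
  · rw [hs, zero_mul, zero_smul]
    refine (Finset.sum_eq_zero fun i _ => ?_).symm
    unfold jumpIntegrand
    refine indicator_apply_eq_zero.2 fun _ => ?_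
    rw [hs, zero_mul, zero_smul]
  · have ht : |D t - a| < η := (abs_sub_le_of_step_ne hs).trans_lt (hv t)
    obtain ⟨i, hi⟩ := mem_iUnion.1 (H.cover ht)
    rw [Finset.sum_eq_single i]
    · rw [jumpIntegrand, indicator_of_mem (show t ∈ V i ∩ {t | |D t - a| < η} from ⟨hi, ht⟩)]
    · intro j _ hj
      exact indicator_of_notMem (fun h' => disjoint_left.1 (H.disjoint j i hj) h'.1 hi) _
    · simp

/-- The surface term of the derivative, in terms of the radii and slopes. -/
noncomputable def surfaceTerm (μ : Fin l → Space d) (γ κ : Fin l → UnitSphere d → ℝ)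
    (f y : Space d → ℝ) : Space d :=
  ∑ i, ∫ n : UnitSphere d, (f (μ i + γ i n • (n : Space d)) * (γ i n ^ (d - 1) / |κ i n|) *
    y (μ i + γ i n • (n : Space d))) • (μ i + γ i n • (n : Space d))
      ∂(volume : Measure (Space d)).toSphere

theorem TransversalLevel.tendsto_diffQuotient [Nontrivial (Space d)]
    (H : TransversalLevel D a η μ γ κ V) (f : DensitySpace U)
    (hA : {t | |D t - a| < η} ⊆ A) (h : DepthSpace U × DensitySpace U) :
    Tendsto (fun q : ℝ × DepthSpace U × DensitySpace U =>
        q.1⁻¹ • (trimmed a A (D + q.1 • q.2.1 : DepthSpace U) (f + q.1 • q.2.2 : DensitySpace U) -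
          trimmed a A D f))
      (𝓝[≠] 0 ×ˢ 𝓝 h) (𝓝 (surfaceTerm μ γ κ f h.1 +
        ∫ t in A, indicator {t | a ≤ D t} (fun t => h.2 t • t) t)) := by
  have hfst : Tendsto (fun q : ℝ × DepthSpace U × DensitySpace U => (q.1, q.2.1))
      (𝓝[≠] 0 ×ˢ 𝓝 h) (𝓝[≠] 0 ×ˢ 𝓝 h.1) :=
    tendsto_fst.prodMk tendsto_snd.fst_nhds
  have hf : ∀ i, ContinuousOn (f : Space d → ℝ) (V i) := fun i => f.2.1.mono (H.image_subset i)
  have hsurf : Tendsto (fun q : ℝ × DepthSpace U × DensitySpace U =>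
      ∑ i, q.1⁻¹ • ∫ t, jumpIntegrand D a η (V i) f (fun t => q.1 * q.2.1 t) t)
      (𝓝[≠] 0 ×ˢ 𝓝 h) (𝓝 (surfaceTerm μ γ κ f h.1)) := by
    refine tendsto_finsetSum _ fun i _ => ?_
    exact ((H.chart i).tendsto_integral_jump H.continuous (H.image_subset i) (hf i)
      (abs_density_le_norm f) h.1).comp hfst
  refine (hsurf.add (H.tendsto_mass (A := A) h)).congr' ?_
  filter_upwards [eventually_small h H.eta_pos] with q ⟨hq0, hq, _⟩
  have hv : ∀ t, |q.1 * q.2.1 t| < η := fun t =>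
    (abs_apply_le_norm (q.1 • q.2.1) t).trans_lt hq
  have hclose : ∀ t, |(D + q.1 • q.2.1) t - D t| ≤ η := fun t => by
    have h2 : (D + q.1 • q.2.1) t - D t = q.1 * q.2.1 t := add_sub_cancel_left (D t) _
    rw [h2]
    exact (hv t).le
  have i1 := (H.integrable_superlevel f _ hclose).restrict (s := A)
  have i2 := (H.integrable_superlevel q.2.2 _ hclose).restrict (s := A)
  have i3 := (H.integrable_superlevel f D fun t => by simp [H.eta_pos.le]).restrict (s := A)
  have e1 : trimmed a A (D + q.1 • q.2.1 : DepthSpace U) (f + q.1 • q.2.2 : DensitySpace U) =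
      trimmed a A (D + q.1 • q.2.1 : DepthSpace U) f +
        q.1 • trimmed a A (D + q.1 • q.2.1 : DepthSpace U) q.2.2 := by
    calc
      _ = ∫ t in A, ((indicator {t | a < (D + q.1 • q.2.1 : DepthSpace U) t}
          fun t => f t • t) t + q.1 • (indicator {t | a < (D + q.1 • q.2.1 : DepthSpace U) t}
            fun t => q.2.2 t • t) t) := by
        refine integral_congr_ae (Eventually.of_forall fun t => ?_)
        have h2 : (f + q.1 • q.2.2 : DensitySpace U) t = f t + q.1 * q.2.2 t := rfl
        by_cases ht : a < (D + q.1 • q.2.1) t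
        · have ht' : t ∈ {t | a < (D + q.1 • q.2.1) t} := ht
          simp only [indicator_of_mem ht', h2, add_smul, mul_smul]
        · have ht' : t ∉ {t | a < (D + q.1 • q.2.1) t} := ht
          simp only [indicator_of_notMem ht', smul_zero, add_zero]
      _ = _ := (integral_add i1 (i2.smul q.1)).trans (congrArg _ (integral_smul q.1
        (indicator {t | a < (D + q.1 • q.2.1 : DepthSpace U) t} fun t => q.2.2 t • t)))
  have e2 : trimmed a A (D + q.1 • q.2.1 : DepthSpace U) f - trimmed a A D f =
      ∑ i, ∫ t, jumpIntegrand D a η (V i) f (fun t => q.1 * q.2.1 t) t := by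
    have hs : ∀ t, (indicator {t | a < (D + q.1 • q.2.1) t} fun t => f t • t) t -
        (indicator {t | a < D t} fun t => f t • t) t =
          ((step a (D t + q.1 * q.2.1 t) - step a (D t)) * f t) • t := fun t => by
      have h2 : (D + q.1 • q.2.1) t = D t + q.1 * q.2.1 t := rfl
      rw [indicator_eq_step_smul, indicator_eq_step_smul]
      beta_reduce
      rw [h2]
      module
    have hi : ∀ i, Integrable (jumpIntegrand D a η (V i) f fun t => q.1 * q.2.1 t) := fun i =>
      (H.chart i).integrable_jumpIntegrand H.continuous (hf i) (abs_density_le_norm f)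
        ((q.2.1.2.mono (H.image_subset i)).const_smul q.1)
    rw [trimmed, trimmed, ← integral_sub i1 i3, ← integral_finsetSum _ fun i _ => hi i]
    simp only [hs, H.jump_eq_sum f hv]
    -- The jumps live in `{|D - a| < η} ⊆ A`, so the surface term does not depend on `A`.
    refine setIntegral_eq_integral_of_forall_compl_eq_zero fun t ht => ?_
    exact Finset.sum_eq_zero fun i _ => indicator_of_notMem (fun h' => ht (hA h'.2)) _
  rw [e1, ← Finset.smul_sum, ← e2, add_sub_right_comm, smul_add, smul_smul, inv_mul_cancel₀ hq0,
    one_smul]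

end Global

/-! ### Continuity and linearity of the derivative -/

section Derivative

variable {d l : ℕ} {U : Set (Space d)}

theorem continuous_surface {w : UnitSphere d → ℝ} {x : UnitSphere d → Space d}
    (hw : Continuous w) (hx : Continuous x) (hxU : ∀ n, x n ∈ U) (y : DepthSpace U) :
    Continuous fun n => (w n * y (x n)) • x n :=
  (hw.mul (y.2.comp_continuous hx hxU)).smul hx

theorem integrable_surface {w : UnitSphere d → ℝ} {x : UnitSphere d → Space d}
    (hw : Continuous w) (hx : Continuous x) (hxU : ∀ n, x n ∈ U) (y : DepthSpace U) :
    Integrable (fun n => (w n * y (x n)) • x n) (volume : Measure (Space d)).toSphere :=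
  (continuous_surface hw hx hxU y).integrable_of_hasCompactSupport
    (HasCompactSupport.of_compactSpace _)

theorem exists_clm_surface {w : UnitSphere d → ℝ} {x : UnitSphere d → Space d}
    (hw : Continuous w) (hx : Continuous x) (hxU : ∀ n, x n ∈ U) :
    ∃ L : DepthSpace U →L[ℝ] Space d, ∀ y : DepthSpace U,
      L y = ∫ n, (w n * y (x n)) • x n ∂(volume : Measure (Space d)).toSphere := by
  have hi := fun y : DepthSpace U => integrable_surface hw hx hxU y
  have hb : Integrable (fun n => |w n| * ‖x n‖) (volume : Measure (Space d)).toSphere :=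
    (hw.abs.mul hx.norm).integrable_of_hasCompactSupport (HasCompactSupport.of_compactSpace _)
  refine ⟨LinearMap.mkContinuous
    { toFun := fun y : DepthSpace U =>
        ∫ n, (w n * y (x n)) • x n ∂(volume : Measure (Space d)).toSphere
      map_add' := fun y z => ?_
      map_smul' := fun c y => ?_ }
    (∫ n, |w n| * ‖x n‖ ∂(volume : Measure (Space d)).toSphere) fun y => ?_, fun y => rfl⟩
  · rw [← integral_add (hi y) (hi z)]
    refine integral_congr_ae (Eventually.of_forall fun n => ?_)
    have h : (y + z : DepthSpace U) (x n) = y (x n) + z (x n) := rfl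
    beta_reduce
    rw [h]
    module
  · rw [RingHom.id_apply, ← integral_smul]
    refine integral_congr_ae (Eventually.of_forall fun n => ?_)
    have h : (c • y : DepthSpace U) (x n) = c * y (x n) := rfl
    beta_reduce
    rw [h]
    module
  · rw [← integral_mul_const]
    refine norm_integral_le_of_norm_le (hb.mul_const _) (Eventually.of_forall fun n => ?_)
    rw [norm_smul, norm_mul, Real.norm_eq_abs, mul_right_comm]
    gcongr
    exact abs_apply_le_norm y (x n)

theorem exists_clm_mass {A B : Set (Space d)} (hB : MeasurableSet B)
    (hb : Bornology.IsBounded B) :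
    ∃ L : DensitySpace U →L[ℝ] Space d, ∀ g : DensitySpace U,
      L g = ∫ t in A, B.indicator (fun t => g t • t) t := by
  obtain ⟨R, hR⟩ := hb.exists_norm_le
  have hi := fun g : DensitySpace U => (integrable_indicator_density g hB hb).restrict (s := A)
  have hc : Integrable (B.indicator fun _ => R) (volume.restrict A) := by
    refine Integrable.restrict ?_
    rw [integrable_indicator_iff hB]
    exact integrableOn_const hb.measure_lt_top.ne
  refine ⟨LinearMap.mkContinuous
    { toFun := fun g : DensitySpace U => ∫ t in A, B.indicator (fun t => g t • t) t
      map_add' := fun y z => ?_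
      map_smul' := fun c y => ?_ }
    (∫ t in A, B.indicator (fun _ => R) t) fun g => ?_, fun y => rfl⟩
  · rw [← integral_add (hi y) (hi z)]
    refine integral_congr_ae (Eventually.of_forall fun t => ?_)
    have h : (y + z : DensitySpace U) t = y t + z t := rfl
    by_cases ht : t ∈ B
    · simp only [indicator_of_mem ht, h, add_smul]
    · simp only [indicator_of_notMem ht, add_zero]
  · rw [RingHom.id_apply, ← integral_smul]
    refine integral_congr_ae (Eventually.of_forall fun t => ?_)
    have h : (c • y : DensitySpace U) t = c * y t := rfl
    by_cases ht : t ∈ B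
    · simp only [indicator_of_mem ht, h, mul_smul]
    · simp only [indicator_of_notMem ht, smul_zero]
  · rw [← integral_mul_const]
    refine norm_integral_le_of_norm_le (hc.mul_const _) (Eventually.of_forall fun t => ?_)
    by_cases ht : t ∈ B
    · rw [indicator_of_mem ht, indicator_of_mem ht, norm_smul, mul_comm]
      gcongr
      · exact (norm_nonneg t).trans (hR t ht)
      · exact hR t ht
      · exact abs_density_le_norm g t
    · rw [indicator_of_notMem ht, indicator_of_notMem ht, norm_zero, zero_mul]

variable {D : DepthSpace U} {a η : ℝ} {μ : Fin l → Space d}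
  {γ κ : Fin l → UnitSphere d → ℝ} {V : Fin l → Set (Space d)}

theorem RadialChart.continuous_point {D : Space d → ℝ} {μ : Space d} {γ κ : UnitSphere d → ℝ}
    {V : Set (Space d)} (H : RadialChart D a η μ γ κ V) :
    Continuous fun n : UnitSphere d => μ + γ n • (n : Space d) :=
  continuous_const.add (H.continuous_radius.smul continuous_subtype_val)

theorem RadialChart.continuous_weight {D : Space d → ℝ} {μ : Space d} {γ κ : UnitSphere d → ℝ}
    {V : Set (Space d)} (H : RadialChart D a η μ γ κ V) (hVU : V ⊆ U) (f : DensitySpace U) :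
    Continuous fun n : UnitSphere d =>
      f (μ + γ n • (n : Space d)) * (γ n ^ (d - 1) / |κ n|) :=
  (f.2.1.comp_continuous H.continuous_point fun n => hVU (H.mem n)).mul
    ((H.continuous_radius.pow _).div H.continuous_slope.abs fun n =>
      (abs_pos.2 (H.slope_neg n).ne).ne')

theorem TransversalLevel.measurableSet_superlevel (H : TransversalLevel D a η μ γ κ V) :
    MeasurableSet {t | a ≤ D t} :=
  (isClosed_le continuous_const H.continuous).measurableSet

theorem TransversalLevel.isBounded_superlevel (H : TransversalLevel D a η μ γ κ V) :
    Bornology.IsBounded {t | a ≤ D t} := by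
  refine H.isCompact.isBounded.subset fun t ht => ?_
  have h1 : a ≤ D t := ht
  have h2 := H.eta_pos
  show a - η ≤ D t
  linarith

theorem TransversalLevel.exists_hadamardDeriv [Nontrivial (Space d)]
    (H : TransversalLevel D a η μ γ κ V) (f : DensitySpace U) {A : Set (Space d)}
    (hA : {t | |D t - a| < η} ⊆ A) :
    ∃ L : (DepthSpace U × DensitySpace U) →L[ℝ] Space d,
      (∀ y g, L (y, g) = surfaceTerm μ γ κ f y +
        ∫ t in A, indicator {t | a ≤ D t} (fun t => g t • t) t) ∧
      HasHadamardDerivAt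
        (fun q : DepthSpace U × DensitySpace U => trimmed a A q.1 q.2) L (D, f) := by
  choose L₁ hL₁ using fun i => exists_clm_surface
    ((H.chart i).continuous_weight (H.image_subset i) f) (H.chart i).continuous_point
    (fun n => H.image_subset i ((H.chart i).mem n))
  obtain ⟨L₂, hL₂⟩ := exists_clm_mass (U := U) (A := A) H.measurableSet_superlevel
    H.isBounded_superlevel
  have hL : ∀ y g, ((∑ i, L₁ i).comp (ContinuousLinearMap.fst ℝ _ _) +
      L₂.comp (ContinuousLinearMap.snd ℝ _ _) :
        (DepthSpace U × DensitySpace U) →L[ℝ] Space d) (y, g) = surfaceTerm μ γ κ f y +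
        ∫ t in A, indicator {t | a ≤ D t} (fun t => g t • t) t := fun y g => by
    simp [surfaceTerm, hL₁, hL₂]
  refine ⟨_, hL, fun h => ?_⟩
  rw [show h = (h.1, h.2) from rfl, hL]
  exact H.tendsto_diffQuotient f hA h

end Derivative

/-! ### From the hypotheses to a transversal level -/

section Hypotheses

variable {d l : ℕ} {U : Set (Space d)} {D : DepthSpace U} {f : DensitySpace U} {a δ : ℝ} {p : ℕ∞}
  {μ : Fin l → Space d} {γ : Fin l → UnitSphere d → ℝ}

theorem isCompact_superlevel {D : Space d → ℝ} (h1 : H1 D) {b : ℝ} (hb : 0 < b) :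
    IsCompact {t | b ≤ D t} := by
  refine Metric.isCompact_of_isClosed_isBounded (isClosed_le continuous_const h1.continuous) ?_
  have h := h1.tendsto_zero.eventually (gt_mem_nhds hb)
  refine (Bornology.isBounded_def.2 ?_)
  filter_upwards [h] with t ht using not_le.2 ht

theorem lt_radius (h1 : H1 D) (h2 : H2 D a δ μ γ) (hδ : SmallDelta D δ μ γ) (i : Fin l)
    (n : UnitSphere d) : δ < γ i n :=
  lt_radius_of_lt_center h1.continuous (h2.strictAnti i) (hδ.lt_center i) h2.delta_pos
    (h2.radius_pos i) n

theorem H3.contDiff_one {D : Space d → ℝ} (h3 : H3 p D δ μ γ) : ContDiff ℝ 1 D :=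
  h3.contDiff.of_le (by exact_mod_cast h3.one_lt.le)

theorem transversalLevel_tauImage {η : ℝ} (hη : 0 < η) (hηa : η < a)
    (h1 : H1 D) (h2 : H2 D a δ μ γ) (hδ : SmallDelta D δ μ γ)
    (h3 : H3 p D δ μ γ) (h4 : H4 D a δ μ γ U f)
    (hcov : {t | |D t - a| ≤ η} ⊆ ⋃ i, tauImage D δ (μ i) (γ i)) :
    TransversalLevel D a η μ γ
      (fun i n => fderiv ℝ (D : Space d → ℝ) (μ i + γ i n • (n : Space d)) n)
      (fun i => tauImage D δ (μ i) (γ i)) := by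
  have hcomp := isCompact_superlevel h1 (sub_pos.2 hηa)
  have hZ : IsCompact {t | |D t - a| ≤ η} := by
    refine hcomp.of_isClosed_subset
      (isClosed_le (h1.continuous.sub continuous_const).abs continuous_const) fun t ht => ?_
    have := (abs_le.1 (show |D t - a| ≤ η from ht)).1
    show a - η ≤ D t
    linarith
  -- The tubes are open, disjoint and cover the band, so the part of the band in one tube is the
  -- band minus the other tubes, a closed subset of a compact set.
  have hZi : ∀ i, IsCompact (tauImage D δ (μ i) (γ i) ∩ {t | |D t - a| ≤ η}) := fun i => by
    have : tauImage D δ (μ i) (γ i) ∩ {t | |D t - a| ≤ η} =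
        {t | |D t - a| ≤ η} ∩ ⋂ j : {j // j ≠ i}, (tauImage D δ (μ j) (γ j))ᶜ := by
      ext t
      constructor
      · rintro ⟨hi, ht⟩
        exact ⟨ht, mem_iInter.2 fun j hj => disjoint_left.1 (hδ.disjoint j i j.2) hj hi⟩
      · rintro ⟨ht, hj⟩
        obtain ⟨k, hk⟩ := mem_iUnion.1 (hcov ht)
        rcases eq_or_ne k i with rfl | hki
        · exact ⟨hk, ht⟩
        · exact absurd hk (mem_iInter.1 hj ⟨k, hki⟩)
    rw [this]
    exact hZ.inter_right (isClosed_iInter fun j => (h3.isOpen_image j).isClosed_compl)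
  refine ⟨hη, h1.continuous, fun i => ?_, hδ.disjoint,
    fun t ht => hcov (le_of_lt (show |D t - a| < η from ht) : |D t - a| ≤ η), h4.isOpen,
    h4.image_subset, hcomp, fun t ht => ?_⟩
  · exact radialChart_tauImage (h2.strictAnti i) (lt_radius h1 h2 hδ i) hη h2.delta_pos
      h3.contDiff_one (h2.level i) (h3.isOpen_image i) (h3.full_rank i) (hZi i)
  · rcases le_or_gt a (D t) with h | h
    · exact h4.level_subset h
    · have ht' : a - η ≤ D t := ht
      have hm : |D t - a| ≤ η := abs_le.2 ⟨by linarith, by linarith⟩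
      obtain ⟨i, hi⟩ := mem_iUnion.1 (hcov hm)
      exact h4.image_subset i hi

theorem surfaceIntegrand_eq (h1 : H1 D) (h2 : H2 D a δ μ γ) (hδ : SmallDelta D δ μ γ)
    (h3 : H3 p D δ μ γ) (f y : Space d → ℝ) (i : Fin l) :
    surfaceIntegrand D a δ (μ i) (γ i) f y = fun n =>
      (f (μ i + γ i n • (n : Space d)) * (γ i n ^ (d - 1) /
        |fderiv ℝ (D : Space d → ℝ) (μ i + γ i n • (n : Space d)) n|) *
          y (μ i + γ i n • (n : Space d))) • (μ i + γ i n • (n : Space d)) := by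
  ext1 n
  have hγ := lt_radius h1 h2 hδ i
  have ht := tau_apply (h2.strictAnti i) (r := γ i n) (n := n)
    ⟨by linarith [h2.delta_pos], by linarith [h2.delta_pos]⟩
  rw [h2.level] at ht
  rw [surfaceIntegrand, ht, absJacobian_tau (h2.strictAnti i) hγ h2.delta_pos h3.contDiff_one
    (h2.level i) (h3.isOpen_image i) (h3.full_rank i)]

end Hypotheses

end TrimmedMean

open TrimmedMean
theorem mainTheorem2 {d l : ℕ} (T a a₁ a₂ δ : ℝ) (p : ℕ∞)
    (U K : Set (Space d)) (D : DepthSpace U) (f : DensitySpace U)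
    (μ : Fin l → Space d) (γ : Fin l → UnitSphere d → ℝ)
    (hD : ∀ t, 0 < D t ∧ D t ≤ T)
    (ha : 0 < a ∧ a < T)
    (h1 : H1 D) (h2 : H2 D a δ μ γ) (hδ : SmallDelta D δ μ γ)
    (h3 : H3 p D δ μ γ) (h4 : H4 D a δ μ γ U f)
    (ha₁ : a₁ < a) (ha₂ : a < a₂) (ha₂T : a₂ < T)
    (hK : K = {t | a₁ ≤ D t ∧ D t < a₂})
    (hKsub : K ⊆ ⋃ i, tauImage D δ (μ i) (γ i)) :
    -- the functionals and the terms of the derivatives are well defined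
    (∀ (y : DepthSpace U) (g : DensitySpace U),
      IntegrableOn (indicator {t | a < y t} (fun t => g t • t)) K volume) ∧
    (∀ (y : DepthSpace U) (i : Fin l),
      Integrable (surfaceIntegrand D a δ (μ i) (γ i) f y)
        (volume : Measure (Space d)).toSphere) ∧
    (∀ g : DensitySpace U, Integrable (indicator {t | a ≤ D t} (fun t => g t • t)) volume) ∧
    (∀ᶠ q : DepthSpace U × DensitySpace U in 𝓝 (D, f),
      Integrable (indicator {t | a < q.1 t} (fun t => q.2 t • t)) volume) ∧
    -- differentiability of the functional on the band `K`
    (∃ L : (DepthSpace U × DensitySpace U) →L[ℝ] Space d,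
      (∀ y g, L (y, g) = trimmedDeriv D a δ μ γ f K y g) ∧
      HasHadamardDerivAt
        (fun q : DepthSpace U × DensitySpace U => trimmed a K q.1 q.2) L (D, f)) ∧
    -- differentiability of the same functional with the integral over the whole space
    (∃ L : (DepthSpace U × DensitySpace U) →L[ℝ] Space d,
      (∀ y g, L (y, g) = trimmedDeriv D a δ μ γ f univ y g) ∧
      HasHadamardDerivAt
        (fun q : DepthSpace U × DensitySpace U => trimmed a univ q.1 q.2) L (D, f)) := by
  -- Polar coordinates need `d ≥ 1`; for `d = 0` all values lie in a one-point space.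
  rcases subsingleton_or_nontrivial (Space d) with hs | hs
  · have hi : ∀ {α : Type} [MeasurableSpace α] (ν : Measure α) (F : α → Space d),
        Integrable F ν := fun ν F => by
      rw [Subsingleton.elim F 0]
      exact integrable_zero _ _ _
    have hL : ∀ F : DepthSpace U × DensitySpace U → Space d,
        HasHadamardDerivAt F (0 : _ →L[ℝ] Space d) (D, f) := fun F h =>
      tendsto_const_nhds.congr fun _ => Subsingleton.elim _ _
    exact ⟨fun y g => hi _ _, fun y i => hi _ _, fun g => hi _ _,
      Eventually.of_forall fun q => hi _ _, ⟨0, fun y g => Subsingleton.elim _ _, hL _⟩,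
      ⟨0, fun y g => Subsingleton.elim _ _, hL _⟩⟩
  -- The first two bounds put the closed band inside `K`; the third makes `a - η` positive, so that
  -- `{D ≥ a - η}` is compact by decay at infinity.
  obtain ⟨η, hη, hη₁, hη₂, hηa⟩ : ∃ η > 0, η < a - a₁ ∧ η < a₂ - a ∧ η < a := by
    obtain ⟨η, hη, h⟩ := exists_between (lt_min (lt_min (sub_pos.2 ha₁) (sub_pos.2 ha₂)) ha.1)
    exact ⟨η, hη, h.trans_le ((min_le_left _ _).trans (min_le_left _ _)),
      h.trans_le ((min_le_left _ _).trans (min_le_right _ _)), h.trans_le (min_le_right _ _)⟩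
  have hband : {t | |D t - a| ≤ η} ⊆ K := fun t ht => by
    have := abs_le.1 (show |D t - a| ≤ η from ht)
    rw [hK]
    exact ⟨by linarith, by linarith⟩
  have H := transversalLevel_tauImage hη hηa h1 h2 hδ h3 h4 (hband.trans hKsub)
  have hKm : MeasurableSet K := by
    rw [hK]
    exact (isClosed_le continuous_const h1.continuous).measurableSet.inter
      (isOpen_lt h1.continuous continuous_const).measurableSet
  have hKb : Bornology.IsBounded K := by
    refine Bornology.IsBounded.subset ?_ hKsub
    exact Bornology.isBounded_iUnion.2 fun i => (H.chart i).isBounded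
  have hderiv : ∀ (A : Set (Space d)) (y : DepthSpace U) (g : DensitySpace U),
      trimmedDeriv D a δ μ γ f A y g = surfaceTerm μ γ
        (fun i n => fderiv ℝ (D : Space d → ℝ) (μ i + γ i n • (n : Space d)) n) f y +
        ∫ t in A, indicator {t | a ≤ D t} (fun t => g t • t) t := fun A y g => by
    simp only [trimmedDeriv, surfaceIntegrand_eq h1 h2 hδ h3, surfaceTerm]
  simp only [hderiv]
  refine ⟨fun y g => ?_, fun y i => ?_,
    fun g => integrable_indicator_density g H.measurableSet_superlevel H.isBounded_superlevel, ?_,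
    H.exists_hadamardDeriv f (fun t ht =>
      hband (le_of_lt (show |D t - a| < η from ht) : |D t - a| ≤ η)),
    H.exists_hadamardDeriv f (subset_univ _)⟩
  -- On `K` no closeness of `y` to `D` is needed: `K` is bounded and lies in `U`, where `y` is
  -- continuous.
  · have hKU : K ⊆ U := hKsub.trans (iUnion_subset h4.image_subset)
    have hm : MeasurableSet (K ∩ (U ∩ {t | a < y t})) :=
      hKm.inter (y.2.isOpen_inter_preimage h4.isOpen isOpen_Ioi).measurableSet
    rw [← inter_assoc, inter_eq_self_of_subset_left hKU] at hm
    rw [← integrable_indicator_iff hKm, indicator_indicator]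
    exact integrable_indicator_density g hm (hKb.subset inter_subset_left)
  · rw [surfaceIntegrand_eq h1 h2 hδ h3]
    exact integrable_surface ((H.chart i).continuous_weight (H.image_subset i) f)
      (H.chart i).continuous_point (fun n => H.image_subset i ((H.chart i).mem n)) y
  · have hn : ∀ᶠ q : DepthSpace U × DensitySpace U in 𝓝 (D, f), ‖q.1 - D‖ < η := by
      have : Continuous fun q : DepthSpace U × DensitySpace U => ‖q.1 - D‖ := by fun_prop
      refine this.continuousAt.eventually (gt_mem_nhds ?_)
      simpa using hη
    filter_upwards [hn] with q hq
    exact H.integrable_superlevel q.2 q.1 fun t =>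
      ((abs_apply_le_norm (q.1 - D) t).trans hq.le)
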